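/- A circuit over the basis $\{\oplus,\wedge,1\}$ is built from $n$ Boolean input variables by two-input gates $\oplus$ and $\wedge$ and constant gates $1$, with unbounded fan-out. Its multiplicative complexity is the number of its $\wedge$-gates, and its total complexity is the number of all its gates. The multiplicative complexity of a Boolean function is the least multiplicative complexity of a circuit that computes it. (1) For all real $c>0$ and $\varepsilon>0$ there is $M_0$ such that for all integers $n\ge 0$ and $M\ge M_0$ with $M\ge cn$: every Boolean function of $n$ variables that is computed by a circuit over $\{\oplus,\wedge,1\}$ of multiplicative complexity $M$ is also computed by a circuit over the same basis of total complexity at most $$\Bigl(\tfrac12+\varepsilon\Bigr)\frac{M(M+2n)}{\log_2 M}.$$ (2) This bound is asymptotically optimal, that is, the constant $\tfrac12$ cannot be lowered: for all real $K>0$ and $\varepsilon>0$ and for every sufficiently large $n$ there is a Boolean function $f$ of $n$ variables whose multiplicative complexity $M$ satisfies $M\ge Kn$, and such that every circuit over $\{\oplus,\wedge,1\}$ computing $f$ has total complexity at least $$\Bigl(\tfrac12-\varepsilon\Bigr)\frac{M(M+2n)}{\log_2 M}.$$ -/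

import Mathlib

/-- A gate over the basis `{⊕, ∧, 1}` whose inputs are chosen among `k` available nodes. -/
inductive XagGate (k : ℕ) : Type
  | one : XagGate k
  | xorGate (i j : Fin k) : XagGate k
  | andGate (i j : Fin k) : XagGate k

namespace XagGate

/-- The value of a gate, given the values of the available nodes. -/
def eval {k : ℕ} (v : Fin k → Bool) : XagGate k → Bool
  | one => true
  | xorGate i j => Bool.xor (v i) (v j)
  | andGate i j => Bool.and (v i) (v j)

/-- Contribution of a gate to the number of conjunction gates. -/
def andWeight {k : ℕ} : XagGate k → ℕ
  | one => 0
  | xorGate _ _ => 0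
  | andGate _ _ => 1

end XagGate

/-- Sequences of `s` gates over `n` input variables, listed in topological order. The inputs of a
gate are among the `n` variables and the outputs of the preceding gates; fan-out is unbounded. -/
inductive XagGates (n : ℕ) : ℕ → Type
  | nil : XagGates n 0
  | snoc {s : ℕ} (c : XagGates n s) (g : XagGate (n + s)) : XagGates n (s + 1)

namespace XagGates

/-- The values of all nodes on the input `x`: first the `n` variables, then the gates in order. -/
def values {n : ℕ} (x : Fin n → Bool) : {s : ℕ} → XagGates n s → Fin (n + s) → Bool
  | _, nil => x
  | _, snoc (s := s) c g =>
      Fin.snoc (n := n + s) (α := fun _ => Bool) (c.values x) (g.eval (c.values x))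

/-- The number of conjunction gates. -/
def andCount {n : ℕ} : {s : ℕ} → XagGates n s → ℕ
  | _, nil => 0
  | _, snoc c g => c.andCount + g.andWeight

end XagGates

/-- A circuit over the basis `{⊕, ∧, 1}` with `n` input variables and one output node (a gate or a
variable). Its total complexity is `size`, the number of all its gates. -/
structure XagCircuit (n : ℕ) where
  size : ℕ
  gates : XagGates n size
  output : Fin (n + size)

namespace XagCircuit

/-- The circuit computes the Boolean function `f`. -/
def Computes {n : ℕ} (C : XagCircuit n) (f : (Fin n → Bool) → Bool) : Prop :=
  ∀ x : Fin n → Bool, C.gates.values x C.output = f x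

/-- The multiplicative complexity of a circuit: the number of its conjunction gates. -/
def andCount {n : ℕ} (C : XagCircuit n) : ℕ := C.gates.andCount

end XagCircuit

/-- `M` is the multiplicative complexity of `f`: the least number of conjunction gates in a circuit
computing `f`. -/
def HasMultComplexity {n : ℕ} (f : (Fin n → Bool) → Bool) (M : ℕ) : Prop :=
  IsLeast {m : ℕ | ∃ C : XagCircuit n, C.Computes f ∧ C.andCount = m} M

/-!
All functions are regarded as taking values in `ZMod 2`, so that the functions computed from a set `S`
by exclusive-or gates are the sums of members of `S`.

*Upper bound.* A circuit with `M` conjunctions is a product chain: a sequence beginning with `1` and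
the variables, in which each further member is a product of two sums of earlier members
(`XagGates.exists_isProductChain`). About `M * (M + 2 * n)` bits describe the index sets of these
`2 * M` sums ("rows"), and the task is to process `2 * log₂ M` bits per gate. The members of the chain
are divided into blocks of length `l`, slightly below `M`, and the sums of all pairs inside a block are
kept available; there are only about `(n + M) * l` of them. The rows are processed in groups of `2 * t`,
where `2 * t` is slightly below `log₂ M`. A column of a group is one of `2 ^ (2 * t)` patterns, and the
sum of the columns of each pattern is formed first. Since there are far fewer patterns than columns in
a block, nearly all columns of equal pattern can be added in pairs, so that the pattern sums take about
half as many gates as there are columns (`Realized.class_sums`). One gate thus serves two columns of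
`2 * t` bits. The rows are then short sums of pattern sums, and the few columns that arise
within the group are added one by one (`Realized.chain_phase`). Adding up over all groups gives
`M * (M + 2 * n) / (2 * log₂ M)` asymptotically (`exists_small_circuit`).

*Optimality.* Systems of `s` distinct gate functions can be labelled in `s !` ways, hence at most about
`s ^ s` functions have circuits of size `s` (`card_smallFunctions_le`). On the other hand, consider
circuits with `T` layers of `B ^ 2` conjunctions. The gate `(l, i)` of layer `c` multiplies `s c i` plus a
linear form in the lower gates by `s' c (i + l)` plus another such form, and selection variables expose
the sums over `i`. The products `s c i * s' c (i + l)` make all gates linearly independent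
(`layerGate_linearIndependent`), and the differences of the output in the directions `s c i` and
`s' c (i + l)` are the two linear forms, so the function determines all coefficients
(`layerOutput_injective`). With `M = T * B ^ 2 + T * B` conjunctions this gives
`2 ^ (B ^ 4 * T * (T - 1))` functions, where the exponent is `(1 - 1 / T) * M ^ 2` asymptotically, while `n`
is negligible against `M`. Comparing the two counts gives a function of `n` variables all of whose
circuits are large (`exists_hard_function`). Its multiplicative complexity is at most `M`, and it is at
least `K * n` because the upper bound would otherwise provide a circuit of quadratic size.
-/

/-! ### Node functions and realizable sets of functions -/

/-- Boolean functions of `n` variables with values in the two-element field. -/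
abbrev BF (n : ℕ) : Type := (Fin n → Bool) → ZMod 2

/-- The identification of `Bool` with the two-element field. -/
def bitVal (b : Bool) : ZMod 2 := if b then 1 else 0

lemma bitVal_xor (a b : Bool) : bitVal (Bool.xor a b) = bitVal a + bitVal b := by
  revert a b; decide

lemma bitVal_and (a b : Bool) : bitVal (Bool.and a b) = bitVal a * bitVal b := by
  revert a b; decide

lemma bitVal_injective : Function.Injective bitVal := by
  intro a b; revert a b; decide

/-- The `i`-th variable as a function. -/
def inputFn {n : ℕ} (i : Fin n) : BF n := fun x => bitVal (x i)

/-- The function computed at node `i` of a gate sequence. -/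
def XagGates.fn {n s : ℕ} (c : XagGates n s) (i : Fin (n + s)) : BF n :=
  fun x => bitVal (c.values x i)

/-- The function computed by a gate whose available nodes carry the functions `u`. -/
def XagGate.fn {n k : ℕ} (u : Fin k → BF n) : XagGate k → BF n
  | .one => 1
  | .xorGate i j => u i + u j
  | .andGate i j => u i * u j

lemma XagGates.fn_nil {n : ℕ} (i : Fin n) : (XagGates.nil : XagGates n 0).fn i = inputFn i := rfl

lemma XagGates.fn_snoc_castSucc {n s : ℕ} (c : XagGates n s) (g : XagGate (n + s))
    (i : Fin (n + s)) : (c.snoc g).fn i.castSucc = c.fn i := by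
  funext x
  exact congrArg bitVal (Fin.snoc_castSucc (n := n + s) (α := fun _ => Bool) _ _ i)

lemma XagGates.fn_snoc_last {n s : ℕ} (c : XagGates n s) (g : XagGate (n + s)) :
    (c.snoc g).fn (Fin.last (n + s)) = g.fn c.fn := by
  funext x
  refine (congrArg bitVal (Fin.snoc_last (n := n + s) (α := fun _ => Bool) _ _)).trans ?_
  cases g with
  | one => rfl
  | xorGate i j => exact bitVal_xor _ _
  | andGate i j => exact bitVal_and _ _

lemma XagGates.fn_snoc_cases {n s : ℕ} (c : XagGates n s) (g : XagGate (n + s))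
    (i : Fin (n + (s + 1))) :
    (∃ j, (c.snoc g).fn i = c.fn j) ∨ (c.snoc g).fn i = g.fn c.fn := by
  rcases Fin.eq_castSucc_or_eq_last (n := n + s) i with ⟨j, rfl⟩ | rfl
  · exact Or.inl ⟨j, c.fn_snoc_castSucc g j⟩
  · exact Or.inr (c.fn_snoc_last g)

/-- Some sequence of at most `s` gates, at most `m` of them conjunctions, computes all members of
`S` at its nodes. -/
def Realized {n : ℕ} (s m : ℕ) (S : Set (BF n)) : Prop :=
  ∃ s' ≤ s, ∃ c : XagGates n s', c.andCount ≤ m ∧ ∀ f ∈ S, ∃ i, c.fn i = f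

namespace Realized

variable {n s m : ℕ} {S : Set (BF n)}

lemma mono {s' m' : ℕ} {S' : Set (BF n)} (h : Realized s m S) (hs : s ≤ s') (hm : m ≤ m')
    (hS : S' ⊆ S) : Realized s' m' S' := by
  obtain ⟨k, hk, c, hc, hf⟩ := h
  exact ⟨k, hk.trans hs, c, hc.trans hm, fun f h => hf f (hS h)⟩

lemma inputs : Realized 0 0 (Set.range (inputFn (n := n))) := by
  refine ⟨0, le_rfl, .nil, le_rfl, ?_⟩
  rintro _ ⟨i, rfl⟩
  exact ⟨i, XagGates.fn_nil i⟩

lemma snoc {k : ℕ} {c : XagGates n k} (hk : k ≤ s) (hc : c.andCount ≤ m)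
    (hS : ∀ f ∈ S, ∃ i, c.fn i = f) (g : XagGate (n + k)) :
    Realized (s + 1) (m + g.andWeight) (insert (g.fn c.fn) S) := by
  refine ⟨k + 1, by omega, c.snoc g, Nat.add_le_add_right hc _, ?_⟩
  rintro f (rfl | hf)
  · exact ⟨_, c.fn_snoc_last g⟩
  · obtain ⟨i, rfl⟩ := hS f hf
    exact ⟨_, c.fn_snoc_castSucc g i⟩

lemma one (h : Realized s m S) : Realized (s + 1) m (insert 1 S) := by
  obtain ⟨k, hk, c, hc, hf⟩ := h
  exact snoc hk hc hf .one

lemma add (h : Realized s m S) {f g : BF n} (hf : f ∈ S) (hg : g ∈ S) :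
    Realized (s + 1) m (insert (f + g) S) := by
  obtain ⟨k, hk, c, hc, hS⟩ := h
  obtain ⟨i, rfl⟩ := hS f hf
  obtain ⟨j, rfl⟩ := hS g hg
  exact snoc hk hc hS (.xorGate i j)

lemma mul (h : Realized s m S) {f g : BF n} (hf : f ∈ S) (hg : g ∈ S) :
    Realized (s + 1) (m + 1) (insert (f * g) S) := by
  obtain ⟨k, hk, c, hc, hS⟩ := h
  obtain ⟨i, rfl⟩ := hS f hf
  obtain ⟨j, rfl⟩ := hS g hg
  exact snoc hk hc hS (.andGate i j)

lemma zero (h : Realized s m S) (h1 : (1 : BF n) ∈ S) : Realized (s + 1) m (insert 0 S) := by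
  have := h.add h1 h1
  rwa [CharTwo.add_self_eq_zero] at this

/-- Adding the members of a family to a function one by one costs one gate each. -/
lemma add_sum {ι : Type*} (h : Realized s m S) {w : BF n} (hw : w ∈ S) (u : Finset ι)
    (t : ι → BF n) (ht : ∀ i ∈ u, t i ∈ S) :
    Realized (s + u.card) m (insert (w + ∑ i ∈ u, t i) S) := by
  classical
  induction u using Finset.induction_on with
  | empty => simpa [Set.insert_eq_of_mem hw] using h
  | insert a u ha ih =>
    have h1 := ih fun i hi => ht i (Finset.mem_insert_of_mem hi)
    have h2 := h1.add (f := w + ∑ i ∈ u, t i) (g := t a) (Set.mem_insert _ _)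
      (Set.mem_insert_of_mem _ (ht a (Finset.mem_insert_self _ _)))
    refine h2.mono ?_ le_rfl ?_
    · rw [Finset.card_insert_of_notMem ha]; omega
    · rw [Finset.sum_insert ha, add_comm (t a), ← add_assoc]
      exact Set.insert_subset_insert (Set.subset_insert _ _)

lemma sum {ι : Type*} (h : Realized s m S) (h0 : (0 : BF n) ∈ S) (u : Finset ι)
    (t : ι → BF n) (ht : ∀ i ∈ u, t i ∈ S) :
    Realized (s + u.card) m (insert (∑ i ∈ u, t i) S) := by
  simpa using h.add_sum h0 u t ht

/-- If each member of a family can be adjoined to every realized set that contains `S`, the whole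
family can be adjoined, and the costs add up. -/
lemma family {ι : Type*} (h : Realized s m S) (u : Finset ι) (t : ι → BF n) (a b : ι → ℕ)
    (ht : ∀ i ∈ u, ∀ s' m' S', S ⊆ S' → Realized s' m' S' →
      Realized (s' + a i) (m' + b i) (insert (t i) S')) :
    Realized (s + ∑ i ∈ u, a i) (m + ∑ i ∈ u, b i) (S ∪ t '' u) := by
  classical
  induction u using Finset.induction_on with
  | empty => simpa using h
  | insert i u hi ih =>
    have h1 := ht i (Finset.mem_insert_self _ _) _ _ _ Set.subset_union_left
      (ih fun j hj => ht j (Finset.mem_insert_of_mem hj))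
    refine h1.mono ?_ ?_ ?_
    · rw [Finset.sum_insert hi]; omega
    · rw [Finset.sum_insert hi]; omega
    · rw [Finset.coe_insert, Set.image_insert_eq, Set.union_insert]

end Realized

/-- An element of the span of a family over the two-element field is the sum of a subfamily. -/
lemma exists_finset_sum_of_mem_span {V : Type*} [AddCommGroup V] [Module (ZMod 2) V]
    {ι : Type*} (h : ι → V) (u : Finset ι) {w : V}
    (hw : w ∈ Submodule.span (ZMod 2) (h '' u)) : ∃ R ⊆ u, w = ∑ i ∈ R, h i := by
  classical
  rw [Submodule.mem_span_image_finset_iff_exists_fun'] at hw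
  obtain ⟨c, rfl⟩ := hw
  refine ⟨u.filter fun i => c i = 1, Finset.filter_subset _ _, ?_⟩
  rw [Finset.sum_filter]
  refine Finset.sum_congr rfl fun i _ => ?_
  rcases (by decide : ∀ z : ZMod 2, z = 0 ∨ z = 1) (c i) with hc | hc <;> simp [hc]

/-- A member of a realized set is computed by a circuit of the same cost. -/
lemma Realized.exists_circuit {n s m : ℕ} {S : Set (BF n)} (h : Realized s m S)
    (f : (Fin n → Bool) → Bool) (hf : (fun x => bitVal (f x)) ∈ S) :
    ∃ C : XagCircuit n, C.Computes f ∧ C.size ≤ s ∧ C.andCount ≤ m := by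
  obtain ⟨k, hk, c, hc, hS⟩ := h
  obtain ⟨i, hi⟩ := hS _ hf
  exact ⟨⟨k, c, i⟩, fun x => bitVal_injective (congrFun hi x), hk, hc⟩

/-! ### Circuits as chains of products of linear forms -/

/-- The span of the first `k` members of a sequence of functions. -/
def spanBelow {n : ℕ} (h : ℕ → BF n) (k : ℕ) : Submodule (ZMod 2) (BF n) :=
  Submodule.span (ZMod 2) (h '' (Finset.range k : Finset ℕ))

lemma spanBelow_mono {n : ℕ} (h : ℕ → BF n) {k l : ℕ} (hkl : k ≤ l) :
    spanBelow h k ≤ spanBelow h l := by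
  refine Submodule.span_mono (Set.image_mono ?_)
  simpa using hkl

lemma mem_spanBelow {n : ℕ} (h : ℕ → BF n) {i k : ℕ} (hik : i < k) : h i ∈ spanBelow h k :=
  Submodule.subset_span ⟨i, by simpa using hik, rfl⟩

lemma spanBelow_congr {n : ℕ} {h h' : ℕ → BF n} {k : ℕ} (hh : ∀ i < k, h i = h' i) :
    spanBelow h k = spanBelow h' k := by
  unfold spanBelow
  rw [Set.image_congr]
  intro i hi
  exact hh i (by simpa using hi)

/-- The first `N` functions of `h` are given; each later one is the product of two sums of earlier
ones, the index sets of the sums being the rows `R (2 * j)` and `R (2 * j + 1)`. -/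
def IsProductChain {n : ℕ} (N : ℕ) (h : ℕ → BF n) (R : ℕ → Finset ℕ) : Prop :=
  ∀ j, R (2 * j) ⊆ Finset.range (N + j) ∧ R (2 * j + 1) ⊆ Finset.range (N + j) ∧
    h (N + j) = (∑ i ∈ R (2 * j), h i) * ∑ i ∈ R (2 * j + 1), h i

lemma XagGates.exists_span_chain {n s : ℕ} (c : XagGates n s) :
    ∃ h : ℕ → BF n, h 0 = 1 ∧ (∀ i : Fin n, h (i + 1) = inputFn i) ∧
      (∀ j < c.andCount, ∃ p ∈ spanBelow h (n + 1 + j), ∃ q ∈ spanBelow h (n + 1 + j),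
        h (n + 1 + j) = p * q) ∧
      ∀ i, c.fn i ∈ spanBelow h (n + 1 + c.andCount) := by
  induction c with
  | nil =>
    refine ⟨fun k => if hk : k - 1 < n then (if k = 0 then 1 else inputFn ⟨k - 1, hk⟩) else 1,
      by simp, fun i => by simp, fun j hj => by simp [XagGates.andCount] at hj, fun i => ?_⟩
    have hi : (i : ℕ) < n := i.2
    have : (XagGates.nil : XagGates n 0).fn i =
        (fun k => if hk : k - 1 < n then (if k = 0 then 1 else inputFn ⟨k - 1, hk⟩) else 1 :
          ℕ → BF n) (i + 1) := by
      simp only [Nat.add_sub_cancel, hi, dite_true, Nat.add_eq_zero_iff, one_ne_zero, and_false,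
        if_false]
      rfl
    rw [this]
    exact mem_spanBelow _ (by omega)
  | @snoc s c g ih =>
    obtain ⟨h, h0, hin, hch, hsp⟩ := ih
    -- A gate that is not a conjunction stays in the span of the chain already found.
    have key : (g.andWeight = 0 → g.fn c.fn ∈ spanBelow h (n + 1 + c.andCount)) →
        g.andWeight = 0 → _ := fun hg h1 =>
      (⟨h, h0, hin, by simpa [XagGates.andCount, h1] using hch, by
        intro i
        have e : (c.snoc g).andCount = c.andCount := by simp [XagGates.andCount, h1]
        rw [e]
        rcases c.fn_snoc_cases g i with ⟨j, hj⟩ | hj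
        · rw [hj]; exact hsp j
        · rw [hj]; exact hg h1⟩ :
      ∃ h : ℕ → BF n, h 0 = 1 ∧ (∀ i : Fin n, h (i + 1) = inputFn i) ∧
      (∀ j < (c.snoc g).andCount, ∃ p ∈ spanBelow h (n + 1 + j), ∃ q ∈ spanBelow h (n + 1 + j),
        h (n + 1 + j) = p * q) ∧
      ∀ i, (c.snoc g).fn i ∈ spanBelow h (n + 1 + (c.snoc g).andCount))
    cases g with
    | one =>
      refine key (fun _ => ?_) rfl
      have := mem_spanBelow h (show 0 < n + 1 + c.andCount by omega)
      rwa [h0] at this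
    | xorGate i j => exact key (fun _ => Submodule.add_mem _ (hsp i) (hsp j)) rfl
    | andGate i j =>
      set k := n + 1 + c.andCount with hk
      have hup : ∀ l < k, Function.update h k (c.fn i * c.fn j) l = h l := fun l hl =>
        Function.update_of_ne (by omega) _ _
      have e : (c.snoc (.andGate i j)).andCount = c.andCount + 1 := rfl
      refine ⟨Function.update h k (c.fn i * c.fn j), ?_, fun i' => ?_, fun j' hj' => ?_,
        fun i' => ?_⟩
      · rw [hup _ (by omega), h0]
      · rw [hup _ (by omega), hin]
      · rw [spanBelow_congr (h' := h) fun l hl => hup l (by omega)]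
        rcases Nat.lt_or_ge j' c.andCount with hlt | hge
        · rw [hup _ (by omega)]
          exact hch j' hlt
        · obtain rfl : j' = c.andCount := by omega
          rw [← hk, Function.update_self]
          exact ⟨_, hsp i, _, hsp j, rfl⟩
      · rw [e]
        rcases c.fn_snoc_cases (.andGate i j) i' with ⟨l, hl⟩ | hl
        · rw [hl]
          refine spanBelow_mono _ (show k ≤ _ by omega) ?_
          rw [spanBelow_congr hup]
          exact hsp l
        · rw [hl]
          have := mem_spanBelow (Function.update h k (c.fn i * c.fn j))
            (show k < n + 1 + (c.andCount + 1) by omega)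
          rwa [Function.update_self] at this

/-- Every node function of a circuit is a sum of members of a product chain that begins with the
constant `1` and the variables and has one product for each conjunction gate. -/
lemma XagGates.exists_isProductChain {n s : ℕ} (c : XagGates n s) :
    ∃ (h : ℕ → BF n) (R : ℕ → Finset ℕ), h 0 = 1 ∧ (∀ i : Fin n, h (i + 1) = inputFn i) ∧
      IsProductChain (n + 1) h R ∧
      ∀ i, ∃ Q ⊆ Finset.range (n + 1 + c.andCount), c.fn i = ∑ j ∈ Q, h j := by
  classical
  obtain ⟨h, h0, hin, hch, hsp⟩ := c.exists_span_chain
  -- Beyond the last conjunction the chain continues with the empty product sums.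
  set h' : ℕ → BF n := fun k => if k < n + 1 + c.andCount then h k else 0 with hh'
  have hup : ∀ k < n + 1 + c.andCount, h' k = h k := fun k hk => by simp [hh', hk]
  have ex : ∀ k ≤ n + 1 + c.andCount, ∀ w ∈ spanBelow h k, ∃ Q ⊆ Finset.range k,
      w = ∑ j ∈ Q, h' j := by
    intro k hk w hw
    rw [← spanBelow_congr (h := h') fun l hl => hup l (by omega)] at hw
    exact exists_finset_sum_of_mem_span h' _ hw
  have step : ∀ j, ∃ A B : Finset ℕ, A ⊆ Finset.range (n + 1 + j) ∧
      B ⊆ Finset.range (n + 1 + j) ∧ h' (n + 1 + j) = (∑ i ∈ A, h' i) * ∑ i ∈ B, h' i := by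
    intro j
    by_cases hj : j < c.andCount
    · obtain ⟨p, hp, q, hq, hpq⟩ := hch j hj
      obtain ⟨A, hA, rfl⟩ := ex _ (by omega) p hp
      obtain ⟨B, hB, rfl⟩ := ex _ (by omega) q hq
      exact ⟨A, B, hA, hB, by rw [hup _ (by omega), hpq]⟩
    · exact ⟨∅, ∅, by simp, by simp, by simp [hh', hj]⟩
  choose A B hA hB hAB using step
  refine ⟨h', fun k => if k % 2 = 0 then A (k / 2) else B (k / 2), ?_, fun i => ?_, fun j => ?_,
    fun i => ex _ le_rfl _ (hsp i)⟩
  · rw [hup _ (by omega), h0]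
  · rw [hup _ (by omega), hin]
  · have e1 : (2 * j + 1) / 2 = j := by omega
    have e2 : (2 * j + 1) % 2 = 1 := by omega
    simpa [e1, e2] using ⟨hA j, hB j, hAB j⟩

/-! ### Evaluation of product chains with few gates -/

/-- The functions `h i` with `i < K` together with `0` and all sums of two of them whose indices
lie in the same block of length `l`. -/
def pairSet {n : ℕ} (h : ℕ → BF n) (l K : ℕ) : Set (BF n) :=
  {0} ∪ h '' Set.Iio K ∪ {w | ∃ i j, i < j ∧ j < K ∧ i / l = j / l ∧ w = h i + h j}

section

variable {n s m l K : ℕ} {h : ℕ → BF n} {S : Set (BF n)}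

lemma zero_mem_pairSet : (0 : BF n) ∈ pairSet h l K := Or.inl (Or.inl rfl)

lemma mem_pairSet {i : ℕ} (hi : i < K) : h i ∈ pairSet h l K := Or.inl (Or.inr ⟨i, hi, rfl⟩)

lemma add_mem_pairSet {i j : ℕ} (hij : i ≠ j) (hi : i < K) (hj : j < K) (hb : i / l = j / l) :
    h i + h j ∈ pairSet h l K := by
  rcases Nat.lt_or_gt_of_ne hij with hlt | hlt
  · exact Or.inr ⟨i, j, hlt, hj, hb, rfl⟩
  · exact Or.inr ⟨j, i, hlt, hi, hb.symm, add_comm _ _⟩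

/-- Inside a block the terms of a sum can be added two at a time. -/
lemma Realized.add_block_sum (hr : Realized s m S) (hS : pairSet h l K ⊆ S) {w : BF n}
    (hw : w ∈ S) (I : Finset ℕ) (hI : I ⊆ Finset.range K) {b : ℕ} (hb : ∀ i ∈ I, i / l = b) :
    Realized (s + (I.card + 1) / 2) m (insert (w + ∑ i ∈ I, h i) S) := by
  classical
  induction I using Finset.strongInduction with
  | H I ih =>
    rcases Finset.eq_empty_or_nonempty I with rfl | ⟨a, ha⟩
    · simpa [Set.insert_eq_of_mem hw] using hr
    · rcases Finset.eq_empty_or_nonempty (I.erase a) with he | ⟨c, hc⟩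
      · obtain rfl : I = {a} := by
          rw [← Finset.insert_erase ha, he]
          rfl
        have haK : a < K := Finset.mem_range.1 (hI ha)
        simpa using hr.add hw (hS (mem_pairSet haK))
      · have hcI := Finset.mem_of_mem_erase hc
        have hca : a ≠ c := (Finset.ne_of_mem_erase hc).symm
        have hsub : (I.erase a).erase c ⊆ I :=
          (Finset.erase_subset _ _).trans (Finset.erase_subset _ _)
        have hcard : ((I.erase a).erase c).card + 2 = I.card := by
          have h1 := Finset.card_erase_add_one hc
          have h2 := Finset.card_erase_add_one ha
          omega
        have h1 := ih ((I.erase a).erase c)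
          ((Finset.erase_ssubset hc).trans_subset (Finset.erase_subset _ _))
          (hsub.trans hI) fun i hi => hb i (hsub hi)
        have h2 := h1.add (Set.mem_insert _ _) (Set.mem_insert_of_mem _ (hS
          (add_mem_pairSet (h := h) hca (Finset.mem_range.1 (hI ha)) (Finset.mem_range.1 (hI hcI))
            ((hb a ha).trans (hb c hcI).symm))))
        refine h2.mono (by omega) le_rfl ?_
        rw [← Finset.add_sum_erase I h ha, ← Finset.add_sum_erase _ h hc]
        refine Set.insert_subset ?_
          ((Set.subset_insert _ _).trans (Set.subset_insert _ _))
        refine Or.inl ?_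
        abel

lemma Realized.add_sum_of_blocks (hr : Realized s m S) (hS : pairSet h l K ⊆ S) {w : BF n}
    (hw : w ∈ S) (I : Finset ℕ) (hI : I ⊆ Finset.range K) :
    Realized (s + ∑ b ∈ Finset.range (K / l + 1), ((I.filter (· / l = b)).card + 1) / 2) m
      (insert (w + ∑ i ∈ I, h i) S) := by
  have key : ∀ B, Realized
      (s + ∑ b ∈ Finset.range B, ((I.filter (· / l = b)).card + 1) / 2) m
      (insert (w + ∑ i ∈ I.filter (· / l < B), h i) S) := by
    intro B
    induction B with
    | zero => simpa [Set.insert_eq_of_mem hw] using hr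
    | succ B ih =>
      have h1 := ih.add_block_sum (l := l) (K := K) (h := h)
        (hS.trans (Set.subset_insert _ _)) (Set.mem_insert _ _)
        (I.filter (· / l = B)) ((Finset.filter_subset _ _).trans hI)
        (b := B) (fun i hi => (Finset.mem_filter.1 hi).2)
      refine h1.mono (by rw [Finset.sum_range_succ]; omega) le_rfl ?_
      have : I.filter (· / l < B + 1) = I.filter (· / l < B) ∪ I.filter (· / l = B) := by
        ext i
        simp only [Finset.mem_filter, Finset.mem_union, ← and_or_left]
        refine and_congr_right fun _ => ?_
        omega
      rw [this, Finset.sum_union, ← add_assoc]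
      · exact Set.insert_subset_insert (Set.subset_insert _ _)
      · rw [Finset.disjoint_filter]
        intro i _ h1 h2
        omega
  have h1 := key (K / l + 1)
  rwa [Finset.filter_true_of_mem] at h1
  intro i hi
  have : i ≤ K := (Finset.mem_range.1 (hI hi)).le
  exact Nat.lt_succ_of_le (Nat.div_le_div_right this)

/-- The indices below `K` are sorted into classes by `pat`. All class sums are obtained with about
`K / 2` gates, because nearly all terms can be added in pairs. -/
lemma Realized.class_sums {P : Type*} [Fintype P] [DecidableEq P] (hr : Realized s m S)
    (hS : pairSet h l K ⊆ S) (pat : ℕ → P) :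
    Realized (s + (K + Fintype.card P * (K / l + 1)) / 2) m
      (S ∪ Set.range fun v => ∑ i ∈ (Finset.range K).filter (pat · = v), h i) := by
  have h1 := hr.family Finset.univ
    (fun v => ∑ i ∈ (Finset.range K).filter (pat · = v), h i)
    (fun v => ∑ b ∈ Finset.range (K / l + 1),
      ((((Finset.range K).filter (pat · = v)).filter (· / l = b)).card + 1) / 2)
    (fun _ => 0) (by
      intro v _ s' m' S' hSS hr'
      have := hr'.add_sum_of_blocks (hS.trans hSS) (hSS (hS zero_mem_pairSet))
        ((Finset.range K).filter (pat · = v)) (Finset.filter_subset _ _)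
      simpa using this)
  refine h1.mono (Nat.add_le_add_left ?_ s) (by simp) (by simp)
  rw [Nat.le_div_iff_mul_le two_pos, Finset.sum_mul]
  calc ∑ v, (∑ b ∈ Finset.range (K / l + 1),
          ((((Finset.range K).filter (pat · = v)).filter (· / l = b)).card + 1) / 2) * 2
      ≤ ∑ v, ∑ b ∈ Finset.range (K / l + 1),
          ((((Finset.range K).filter (pat · = v)).filter (· / l = b)).card + 1) := by
        refine Finset.sum_le_sum fun v _ => ?_
        rw [Finset.sum_mul]
        exact Finset.sum_le_sum fun b _ => Nat.div_mul_le_self _ _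
    _ = ∑ v, (((Finset.range K).filter (pat · = v)).card + (K / l + 1)) := by
        refine Finset.sum_congr rfl fun v _ => ?_
        rw [Finset.sum_add_distrib, ← Finset.card_eq_sum_card_fiberwise]
        · simp
        · intro i hi
          have : i ≤ K := (Finset.mem_range.1 (Finset.mem_filter.1 hi).1).le
          simpa using Nat.lt_succ_of_le (Nat.div_le_div_right (c := l) this)
    _ = K + Fintype.card P * (K / l + 1) := by
        rw [Finset.sum_add_distrib, ← Finset.card_eq_sum_card_fiberwise]
        · simp
        · intro i _
          simp

lemma Realized.pairSet_succ (hl : 0 < l) {X : Set (BF n)}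
    (hr : Realized s m (insert (h K) (pairSet h l K ∪ X))) :
    Realized (s + l) m (pairSet h l (K + 1) ∪ X) := by
  set u := (Finset.range K).filter (· / l = K / l) with hu
  have hcard : u.card ≤ l := by
    have : u ⊆ Finset.Ico (K / l * l) (K / l * l + l) := by
      intro i hi
      have h2 := (Finset.mem_filter.1 hi).2
      have h3 := Nat.div_mul_le_self i l
      have h4 := Nat.lt_div_mul_add (a := i) hl
      rw [h2] at h3 h4
      exact Finset.mem_Ico.2 ⟨h3, h4⟩
    simpa using Finset.card_le_card this
  have h1 := hr.family u (fun i => h i + h K) (fun _ => 1) (fun _ => 0) (by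
    intro i hi s' m' S' hSS hr'
    have hiK : i < K := Finset.mem_range.1 (Finset.mem_filter.1 hi).1
    exact hr'.add (hSS (Or.inr (Or.inl (mem_pairSet hiK)))) (hSS (Or.inl rfl)))
  refine h1.mono (by simpa using hcard) (by simp) ?_
  rintro f (((h0 | ⟨i, hi, rfl⟩) | ⟨i, j, hij, hj, hb, rfl⟩) | hX)
  · exact Or.inl (Or.inr (Or.inl (Or.inl (Or.inl h0))))
  · rcases Nat.lt_succ_iff_lt_or_eq.1 hi with hlt | rfl
    · exact Or.inl (Or.inr (Or.inl (mem_pairSet hlt)))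
    · exact Or.inl (Or.inl rfl)
  · rcases Nat.lt_succ_iff_lt_or_eq.1 hj with hlt | rfl
    · exact Or.inl (Or.inr (Or.inl (Or.inr ⟨i, j, hij, hlt, hb, rfl⟩)))
    · exact Or.inr ⟨i, Finset.mem_coe.2 (Finset.mem_filter.2 ⟨Finset.mem_range.2 hij, hb⟩), rfl⟩
  · exact Or.inl (Or.inr (Or.inr hX))

/-- The next `t` products of a chain. The `2 * t` rows that they need are summed over the functions
already present by way of the classes of equal column patterns; the at most `t` further terms of
each row are added one by one. -/
lemma Realized.chain_phase {N : ℕ} {R : ℕ → Finset ℕ} (hch : IsProductChain N h R) (hl : 0 < l)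
    (j t : ℕ) (hr : Realized s m (pairSet h l (N + j))) :
    Realized (s + ((N + j + 2 ^ (2 * t) * ((N + j) / l + 1)) / 2 + 2 * t * 2 ^ (2 * t) +
      t * (2 * t + 1 + l))) (m + t) (pairSet h l (N + j + t)) := by
  classical
  set K := N + j with hK
  set pat : ℕ → Fin (2 * t) → Bool := fun i ρ => decide (i ∈ R (2 * j + ρ)) with hpat
  set row : Fin (2 * t) → BF n := fun ρ => ∑ i ∈ (R (2 * j + ρ)).filter (· < K), h i with hrow
  have h1 := hr.class_sums le_rfl pat
  have h2 := h1.family Finset.univ row (fun _ => 2 ^ (2 * t)) (fun _ => 0) (by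
    intro ρ _ s' m' S' hSS hr'
    have h3 := hr'.sum (hSS (Or.inl zero_mem_pairSet))
      (Finset.univ.filter fun v : Fin (2 * t) → Bool => v ρ = true)
      (fun v => ∑ i ∈ (Finset.range K).filter (pat · = v), h i)
      (fun v _ => hSS (Or.inr ⟨v, rfl⟩))
    refine h3.mono (Nat.add_le_add_left ((Finset.card_le_univ _).trans (by simp)) _) le_rfl ?_
    refine (Set.insert_subset_insert le_rfl).trans_eq ?_
    congr 1
    have e : (R (2 * j + ρ)).filter (· < K) =
        (Finset.range K).filter (fun i => pat i ρ = true) := by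
      ext i
      simp [hpat, and_comm]
    simp only [hrow]
    rw [e, ← Finset.sum_fiberwise_of_maps_to (s := (Finset.range K).filter fun i => pat i ρ = true)
      (t := Finset.univ.filter fun v : Fin (2 * t) → Bool => v ρ = true) (g := pat)
      (fun i hi => by simpa using (Finset.mem_filter.1 hi).2)]
    refine Finset.sum_congr rfl fun v hv => ?_
    refine Finset.sum_congr ?_ fun _ _ => rfl
    ext i
    simp only [Finset.mem_filter, Finset.mem_univ, true_and] at hv ⊢
    constructor
    · rintro ⟨⟨hi, -⟩, h5⟩
      exact ⟨hi, h5⟩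
    · rintro ⟨hi, h5⟩
      exact ⟨⟨hi, by rw [h5]; exact hv⟩, h5⟩)
  have key : ∀ e ≤ t, Realized
      (s + ((K + 2 ^ (2 * t) * (K / l + 1)) / 2 + 2 * t * 2 ^ (2 * t) + e * (2 * t + 1 + l)))
      (m + e) (pairSet h l (K + e) ∪ Set.range row) := by
    intro e
    induction e with
    | zero =>
      intro _
      refine h2.mono ?_ (by simp) ?_
      · simp
        omega
      · rintro f (hf | hf)
        · exact Or.inl (Or.inl hf)
        · exact Or.inr (by simpa using hf)
    | succ e ih =>
      intro het
      obtain ⟨hA, hB, hAB⟩ := hch (j + e)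
      -- A row of the current product: the known partial sum and the terms of this phase.
      have full : ∀ ρ : Fin (2 * t), R (2 * j + ρ) ⊆ Finset.range (K + e) →
          ∀ s' m' S', pairSet h l (K + e) ∪ Set.range row ⊆ S' → Realized s' m' S' →
            Realized (s' + t) m' (insert (∑ i ∈ R (2 * j + ρ), h i) S') := by
        intro ρ hρ s' m' S' hSS hr'
        have h3 := hr'.add_sum (hSS (Or.inr ⟨ρ, rfl⟩)) ((R (2 * j + ρ)).filter (¬ · < K)) h
          (fun i hi => hSS (Or.inl (mem_pairSet
            (Finset.mem_range.1 (hρ (Finset.mem_filter.1 hi).1)))))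
        rw [hrow, Finset.sum_filter_add_sum_filter_not] at h3
        refine h3.mono (Nat.add_le_add_left ?_ _) le_rfl le_rfl
        have : (R (2 * j + ρ)).filter (¬ · < K) ⊆ Finset.Ico K (K + e) := by
          intro i hi
          obtain ⟨h5, h6⟩ := Finset.mem_filter.1 hi
          exact Finset.mem_Ico.2 ⟨not_lt.1 h6, Finset.mem_range.1 (hρ h5)⟩
        have := Finset.card_le_card this
        rw [Nat.card_Ico] at this
        omega
      have e1 : 2 * (j + e) = 2 * j + 2 * e := by ring
      have e2 : 2 * (j + e) + 1 = 2 * j + (2 * e + 1) := by ring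
      rw [e2, e1, ← add_assoc, ← hK] at hAB
      rw [e1, ← add_assoc N, ← hK] at hA
      rw [e2, ← add_assoc N, ← hK] at hB
      have h3 := full ⟨2 * e, by omega⟩ hA _ _ _ le_rfl (ih (by omega))
      have h4 := full ⟨2 * e + 1, by omega⟩ hB _ _ _ (Set.subset_insert _ _) h3
      have h5 := h4.mul (Set.mem_insert_of_mem _ (Set.mem_insert _ _)) (Set.mem_insert _ _)
      simp only [] at h5
      rw [← hAB] at h5
      have h6 := Realized.pairSet_succ (X := Set.range row) hl (h5.mono le_rfl le_rfl
        (Set.insert_subset_insert ((Set.subset_insert _ _).trans (Set.subset_insert _ _))))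
      refine h6.mono ?_ (by omega) le_rfl
      rw [add_one_mul]
      omega
  exact (key t le_rfl).mono le_rfl le_rfl Set.subset_union_left

/-- A product chain is evaluated in `D` phases of `t` products each. -/
lemma Realized.chain {N : ℕ} {R : ℕ → Finset ℕ} (hch : IsProductChain N h R) (hl : 0 < l)
    (t D : ℕ) (hr : Realized s m (insert 0 (h '' Set.Iio N))) :
    Realized (s + N * l + ∑ d ∈ Finset.range D,
      ((N + d * t + 2 ^ (2 * t) * ((N + d * t) / l + 1)) / 2 + 2 * t * 2 ^ (2 * t) +
        t * (2 * t + 1 + l))) (m + D * t) (pairSet h l (N + D * t)) := by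
  have h0 : ∀ k ≤ N, Realized (s + k * l) m (pairSet h l k ∪ insert 0 (h '' Set.Iio N)) := by
    intro k
    induction k with
    | zero =>
      intro _
      refine hr.mono (by omega) le_rfl ?_
      rintro f (((h0 | ⟨i, hi, rfl⟩) | ⟨i, j, hij, hj, hb, rfl⟩) | hX)
      · exact Or.inl h0
      · exact absurd hi (Nat.not_lt_zero i)
      · omega
      · exact hX
    | succ k ih =>
      intro hk
      refine (Realized.pairSet_succ (X := insert 0 (h '' Set.Iio N)) hl
        ((ih (by omega)).mono le_rfl le_rfl ?_)).mono (by rw [add_one_mul]; omega) le_rfl le_rfl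
      exact Set.insert_subset (Or.inr (Or.inr ⟨k, hk, rfl⟩)) le_rfl
  induction D with
  | zero => exact (h0 N le_rfl).mono (by simp) (by omega) (by rw [zero_mul]; exact Set.subset_union_left)
  | succ D ih =>
    refine (ih.chain_phase hch hl (D * t) t).mono ?_ ?_ ?_
    · rw [Finset.sum_range_succ]
      omega
    · rw [add_one_mul]
      omega
    · rw [add_one_mul, add_assoc]

end

/-- Every function computed with at most `M` conjunctions has a circuit whose size is bounded in
terms of `M`, the number of variables, the phase length `t` and the block length `l`. -/
lemma XagCircuit.exists_size_le {n M : ℕ} {f : (Fin n → Bool) → Bool} (C : XagCircuit n)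
    (hC : C.Computes f) (hM : C.andCount ≤ M) {t l D : ℕ} (hl : 0 < l) (hD : M ≤ D * t) :
    ∃ C' : XagCircuit n, C'.Computes f ∧
      C'.size ≤ 2 + (n + 1) * l + ∑ d ∈ Finset.range D,
      ((n + 1 + d * t + 2 ^ (2 * t) * ((n + 1 + d * t) / l + 1)) / 2 + 2 * t * 2 ^ (2 * t) +
        t * (2 * t + 1 + l)) + (n + 1 + M) := by
  obtain ⟨h, R, h0, hin, hch, hsp⟩ := C.gates.exists_isProductChain
  have hs : Realized 2 0 (insert 0 (h '' Set.Iio (n + 1))) := by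
    refine (Realized.inputs.one.zero (Set.mem_insert _ _)).mono le_rfl le_rfl ?_
    rintro f (rfl | ⟨i, hi, rfl⟩)
    · exact Or.inl rfl
    · rcases i with _ | i
      · rw [h0]; exact Or.inr (Or.inl rfl)
      · rw [Set.mem_Iio] at hi
        exact Or.inr (Or.inr ⟨⟨i, by omega⟩, (hin ⟨i, by omega⟩).symm⟩)
  obtain ⟨Q, hQ, hfQ⟩ := hsp C.output
  have hQ' : ∀ i ∈ Q, i < n + 1 + C.andCount := fun i hi => Finset.mem_range.1 (hQ hi)
  have h1 := (hs.chain hch hl t D).sum zero_mem_pairSet Q h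
    (fun i hi => mem_pairSet (by have := hQ' i hi; omega))
  rw [← hfQ] at h1
  have hcard : Q.card ≤ n + 1 + M :=
    (Finset.card_le_card hQ).trans (by rw [Finset.card_range]; exact Nat.add_le_add_left hM _)
  obtain ⟨C', hC', hs', -⟩ := h1.exists_circuit f (Or.inl (funext fun x => by
    rw [← hC x]; rfl))
  exact ⟨C', hC', hs'.trans (Nat.add_le_add_left hcard _)⟩

/-! ### The upper bound on the size -/

/-- Logarithms grow more slowly than positive powers. -/
lemma eventually_mul_logb_le_rpow (K a : ℝ) (ha : 0 < a) :
    ∀ᶠ x : ℝ in Filter.atTop, K * Real.logb 2 x ≤ x ^ a := by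
  have h2 : 0 < Real.log 2 := Real.log_pos one_lt_two
  have h := (isLittleO_log_rpow_atTop ha).bound
    (show 0 < Real.log 2 / (|K| + 1) by positivity)
  filter_upwards [h, Filter.eventually_ge_atTop 1] with x hx h1
  have hlog : 0 ≤ Real.log x := Real.log_nonneg h1
  rw [Real.norm_of_nonneg hlog, Real.norm_of_nonneg (by positivity)] at hx
  rw [Real.logb, mul_div_assoc', div_le_iff₀ h2]
  have hK : K * Real.log x ≤ (|K| + 1) * Real.log x :=
    mul_le_mul_of_nonneg_right ((le_abs_self K).trans (by linarith)) hlog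
  have h3 := mul_le_mul_of_nonneg_left hx (show 0 ≤ |K| + 1 by positivity)
  rw [← mul_assoc, mul_div_cancel₀ _ (by positivity)] at h3
  linarith

/-- The cost of evaluating a product chain, with the phases summed. -/
lemma chain_cost_le {N M t l : ℕ} (ht : 1 ≤ t) (htM : t ≤ M) :
    ((2 + N * l + ∑ d ∈ Finset.range (M / t + 1),
      ((N + d * t + 2 ^ (2 * t) * ((N + d * t) / l + 1)) / 2 + 2 * t * 2 ^ (2 * t) +
        t * (2 * t + 1 + l)) + (N + M) : ℕ) : ℝ) ≤
      ((M : ℝ) + t) * (M + 2 * N) / (4 * t) + M * (2 ^ (2 * t) * ((N + M) / l + 1)) +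
        2 * M * (2 * 2 ^ (2 * t) + 2 * t + 1 + l) + N * l + (N + M + 2) := by
  have ht' : (1 : ℝ) ≤ t := by exact_mod_cast ht
  have htM' : (t : ℝ) ≤ M := by exact_mod_cast htM
  set w : ℝ := 2 ^ (2 * t) with hw
  have hw0 : 0 ≤ w := by positivity
  set q := M / t with hq
  have hqt : (q : ℝ) * t ≤ M := by exact_mod_cast Nat.div_mul_le_self M t
  have hterm : ∀ d ∈ Finset.range (q + 1),
      (((N + d * t + 2 ^ (2 * t) * ((N + d * t) / l + 1)) / 2 + 2 * t * 2 ^ (2 * t) +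
        t * (2 * t + 1 + l) : ℕ) : ℝ) ≤
      (N : ℝ) / 2 + t / 2 * d + (w * ((N + M) / l + 1) / 2 + t * (2 * w + 2 * t + 1 + l)) := by
    intro d hd
    have hd' : d ≤ q := Nat.lt_succ_iff.1 (Finset.mem_range.1 hd)
    have hdt : d * t ≤ M := (Nat.mul_le_mul_right t hd').trans (Nat.div_mul_le_self M t)
    have h1 : (((N + d * t) / l : ℕ) : ℝ) ≤ ((N : ℝ) + M) / l := by
      refine (Nat.cast_div_le).trans ?_
      have : ((N + d * t : ℕ) : ℝ) ≤ (N : ℝ) + M := by exact_mod_cast Nat.add_le_add_left hdt N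
      gcongr
    have h2 : (((N + d * t + 2 ^ (2 * t) * ((N + d * t) / l + 1)) / 2 : ℕ) : ℝ) ≤
        ((N : ℝ) + d * t + w * ((N + M) / l + 1)) / 2 := by
      refine (Nat.cast_div_le).trans ?_
      push_cast
      rw [← hw]
      gcongr
    push_cast at h2 ⊢
    rw [← hw]
    linarith
  have hsum : (∑ d ∈ Finset.range (q + 1), (d : ℝ)) = (q + 1) * q / 2 := by
    have := Finset.sum_range_id_mul_two (q + 1)
    rw [Nat.add_sub_cancel] at this
    have h' := congrArg (Nat.cast : ℕ → ℝ) this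
    push_cast at h'
    linarith
  have hS := Finset.sum_le_sum hterm
  rw [Finset.sum_add_distrib, Finset.sum_add_distrib, ← Finset.mul_sum, hsum] at hS
  simp only [Finset.sum_const, Finset.card_range, nsmul_eq_mul] at hS
  push_cast [← hw] at hS ⊢
  have hq1 : ((q : ℝ) + 1) * t ≤ M + t := by linarith
  have hq2 : (q : ℝ) + 1 ≤ 2 * M := by
    have : ((q : ℝ) + 1) * 1 ≤ (q + 1) * t := by gcongr
    linarith
  have e1 : ((q : ℝ) + 1) * (N / 2) + t / 2 * ((q + 1) * q / 2) ≤
      ((M : ℝ) + t) * (M + 2 * N) / (4 * t) := by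
    rw [le_div_iff₀ (by positivity)]
    have h3 : ((q : ℝ) + 1) * t * (2 * N + q * t) ≤ (M + t) * (M + 2 * N) := by
      have : (2 * N + q * t : ℝ) ≤ M + 2 * N := by linarith
      gcongr
    nlinarith [h3]
  have e2 : ((q : ℝ) + 1) * (w * ((N + M) / l + 1) / 2 + t * (2 * w + 2 * t + 1 + l)) ≤
      M * (w * ((N + M) / l + 1)) + 2 * M * (2 * w + 2 * t + 1 + l) := by
    have h3 : ((q : ℝ) + 1) * (w * ((N + M) / l + 1) / 2) ≤
        2 * M * (w * ((N + M) / l + 1) / 2) := by gcongr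
    have h4 : ((q : ℝ) + 1) * t * (2 * w + 2 * t + 1 + l) ≤
        2 * M * (2 * w + 2 * t + 1 + l) := by
      have : ((q : ℝ) + 1) * t ≤ 2 * M := by linarith
      gcongr
    linarith
  linarith

/-- All terms of the cost except the leading one are of order `M ^ 2 / y`. -/
lemma chain_cost_lower_order {N M t l w y Q : ℝ} (hN : 0 ≤ N) (hNM : N ≤ Q * M) (hM : 1 ≤ M)
    (hy : 1 ≤ y) (hyM : y ≤ M) (hw : w ≤ M / y ^ 2) (hl1 : M / y ≤ l) (hl2 : l ≤ 2 * (M / y))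
    (ht : 2 * t + 1 ≤ M / y) :
    M * (w * ((N + M) / l + 1)) + 2 * M * (2 * w + 2 * t + 1 + l) + N * l + (N + M + 2) ≤
      (4 * Q + 15) * (M ^ 2 / y) := by
  have hy0 : 0 < y := by linarith
  have hM0 : 0 < M := by linarith
  have hu : 0 < M / y := by positivity
  have hQ : 0 ≤ Q := by
    by_contra hneg
    nlinarith
  have h1 : (N + M) / l + 1 ≤ (Q + 2) * y := by
    have : (N + M) / l ≤ (Q + 1) * y := by
      rw [div_le_iff₀ (by linarith)]
      calc N + M ≤ (Q + 1) * M := by linarith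
        _ = (Q + 1) * y * (M / y) := by field_simp
        _ ≤ (Q + 1) * y * l := by gcongr
    linarith
  have hl0 : 0 < l := by linarith
  have h2 : w * ((N + M) / l + 1) ≤ (Q + 2) * (M / y) := by
    calc w * ((N + M) / l + 1) ≤ M / y ^ 2 * ((Q + 2) * y) := by gcongr
      _ = (Q + 2) * (M / y) := by field_simp
  have h3 : M / y ^ 2 ≤ M / y := by
    have : y ≤ y ^ 2 := by nlinarith
    gcongr
  have h4 : 1 ≤ M / y := (one_le_div hy0).2 hyM
  have h5 : N * l ≤ Q * M * (2 * (M / y)) := by gcongr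
  have h6 : 2 * w + 2 * t + 1 + l ≤ 5 * (M / y) := by linarith
  have h7 : N + M + 2 ≤ (Q + 3) * M * (M / y) := by
    calc N + M + 2 ≤ (Q + 3) * M * 1 := by linarith
      _ ≤ _ := by gcongr
  have e : M ^ 2 / y = M * (M / y) := by ring
  rw [e]
  have h8 := mul_le_mul_of_nonneg_left h2 hM0.le
  have h9 := mul_le_mul_of_nonneg_left h6 (show 0 ≤ 2 * M by linarith)
  linarith

/-- The choice of constants: losses by factors `1 + e` and `1 - 2 * e` and by a summand `e` fit
into the tolerance `20 * e`. -/
lemma leading_term_le {M n t lam e : ℝ} (he : 0 < e) (he1 : e ≤ 1 / 20) (hM : 0 < M) (hn : 0 ≤ n)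
    (hlam : 0 < lam) (ht : (1 - 2 * e) * lam / 2 ≤ t) (htM : t ≤ e * M) (h2 : 2 ≤ e * M) :
    (M + t) * (M + 2 * (n + 1)) / (4 * t) + e * (M ^ 2 / lam) ≤
      (1 / 2 + 20 * e) * (M * (M + 2 * n) / lam) := by
  have h0 : 0 < (1 - 2 * e) * lam / 2 := by
    have : 0 < 1 - 2 * e := by linarith
    positivity
  have h1 : 0 < 1 - 2 * e := by linarith
  have h3 : (M + t) * (M + 2 * (n + 1)) / (4 * t) ≤
      ((1 + e) * M) * ((1 + e) * (M + 2 * n)) / (4 * ((1 - 2 * e) * lam / 2)) := by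
    have a1 : M + t ≤ (1 + e) * M := by linarith
    have a2 : M + 2 * (n + 1) ≤ (1 + e) * (M + 2 * n) := by nlinarith
    have : 0 ≤ t := by linarith
    gcongr
  have h4 : ((1 + e) * M) * ((1 + e) * (M + 2 * n)) / (4 * ((1 - 2 * e) * lam / 2)) =
      (1 + e) ^ 2 / (2 * (1 - 2 * e)) * (M * (M + 2 * n) / lam) := by
    field_simp
    ring
  have h5 : (1 + e) ^ 2 / (2 * (1 - 2 * e)) ≤ 1 / 2 + 19 * e := by
    rw [div_le_iff₀ (by linarith)]
    nlinarith
  have h6 : M ^ 2 / lam ≤ M * (M + 2 * n) / lam := by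
    rw [sq]
    gcongr
    linarith
  have h7 : 0 ≤ M * (M + 2 * n) / lam := by positivity
  rw [h4] at h3
  have h8 := mul_le_mul_of_nonneg_right h5 h7
  have h9 := mul_le_mul_of_nonneg_left h6 he.le
  linarith

/-- A function with at most `M` conjunctions has a circuit whose total size is asymptotically at
most `M * (M + 2 * n) / (2 * log₂ M)`. -/
theorem exists_small_circuit (c : ℝ) (hc : 0 < c) (ε : ℝ) (hε : 0 < ε) :
    ∃ M₀ : ℕ, ∀ n M : ℕ, M₀ ≤ M → c * (n : ℝ) ≤ (M : ℝ) → ∀ f : (Fin n → Bool) → Bool,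
      (∃ C : XagCircuit n, C.Computes f ∧ C.andCount ≤ M) →
        ∃ C : XagCircuit n, C.Computes f ∧
          (C.size : ℝ) ≤
            (1 / 2 + ε) * ((M : ℝ) * ((M : ℝ) + 2 * (n : ℝ)) / Real.logb 2 (M : ℝ)) := by
  set e : ℝ := min ε 1 / 20 with he
  have he0 : 0 < e := by positivity
  have he1 : e ≤ 1 / 20 := by
    have := min_le_right ε 1
    linarith
  have heε : 20 * e ≤ ε := by
    have := min_le_left ε 1
    linarith
  set Q : ℝ := 1 / c + 1 with hQ
  have hev : ∀ᶠ x : ℝ in Filter.atTop, 1 ≤ x ∧ 2 ≤ e * x ∧ 2 / e ≤ Real.logb 2 x ∧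
      1 / e * Real.logb 2 x ≤ x ^ (1 : ℝ) ∧ 2 * Real.logb 2 x ≤ x ^ (1 / 2 : ℝ) ∧
      (4 * Q + 15) / e * Real.logb 2 x ≤ x ^ (e / 2) := by
    filter_upwards [Filter.eventually_ge_atTop 1, Filter.eventually_ge_atTop (2 / e),
      (Real.tendsto_logb_atTop one_lt_two).eventually_ge_atTop (2 / e),
      eventually_mul_logb_le_rpow (1 / e) 1 one_pos,
      eventually_mul_logb_le_rpow 2 (1 / 2) (by norm_num),
      eventually_mul_logb_le_rpow ((4 * Q + 15) / e) (e / 2) (by positivity)]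
      with x h1 h2 h3 h4 h5 h6
    exact ⟨h1, by rwa [div_le_iff₀' he0] at h2, h3, h4, h5, h6⟩
  obtain ⟨M₀, hM₀⟩ := Filter.eventually_atTop.1 (tendsto_natCast_atTop_atTop.eventually hev)
  refine ⟨M₀, fun n M hM hcn f ⟨C, hC, hCM⟩ => ?_⟩
  obtain ⟨h1, h2, h3, h4, h5, h6⟩ := hM₀ M hM
  set x : ℝ := (M : ℝ) with hx
  set lam := Real.logb 2 x with hlam
  have hx0 : 0 < x := by linarith
  have h2e : 40 ≤ 2 / e := by
    rw [le_div_iff₀ he0]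
    linarith
  have hlam0 : 0 < lam := by linarith
  rw [Real.rpow_one, one_div, inv_mul_le_iff₀ he0] at h4
  -- The phase length is just under half of `log₂ M`, and the block length is `M ^ (1 - e / 2)`.
  set t := ⌊(1 - e) * lam / 2⌋₊ with ht
  set y := x ^ (e / 2) with hy
  have hy1 : 1 ≤ y := Real.one_le_rpow h1 (by positivity)
  have hy0 : 0 < y := by linarith
  have hxy : x / y = x ^ (1 - e / 2) := by rw [Real.rpow_sub hx0, Real.rpow_one]
  have hxy2 : x / y ^ 2 = x ^ (1 - e) := by
    rw [Real.rpow_sub hx0, Real.rpow_one, hy, ← Real.rpow_natCast, ← Real.rpow_mul hx0.le]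
    norm_num
  have hyx : y ≤ x := by
    calc y ≤ x ^ (1 : ℝ) := Real.rpow_le_rpow_of_exponent_le h1 (by linarith)
      _ = x := Real.rpow_one x
  have hxy1 : 1 ≤ x / y := (one_le_div hy0).2 hyx
  have ht1 : (t : ℝ) ≤ (1 - e) * lam / 2 := Nat.floor_le (by
    have : 0 ≤ 1 - e := by linarith
    positivity)
  have ht2 : (1 - 2 * e) * lam / 2 ≤ t := by
    have h7 := Nat.lt_floor_add_one ((1 - e) * lam / 2)
    have h8 : 2 ≤ lam * e := by rwa [div_le_iff₀ he0] at h3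
    linarith
  have htpos : 1 ≤ t := by
    have : (1 : ℝ) ≤ t := by nlinarith
    exact_mod_cast this
  have htlam : (t : ℝ) ≤ lam / 2 := by nlinarith
  have htx : (t : ℝ) ≤ e * x := by linarith
  have htM : t ≤ M := by
    have : (t : ℝ) ≤ x := by nlinarith
    exact Nat.cast_le.1 (this.trans_eq hx)
  have ht3 : 2 * (t : ℝ) + 1 ≤ x / y := by
    have h7 : x ^ (1 / 2 : ℝ) ≤ x ^ (1 - e / 2) :=
      Real.rpow_le_rpow_of_exponent_le h1 (by linarith)
    rw [hxy]
    linarith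
  have hw : (2 : ℝ) ^ (2 * t) ≤ x / y ^ 2 := by
    rw [hxy2]
    have h7 : x = 2 ^ lam := (Real.rpow_logb two_pos (by norm_num) hx0).symm
    rw [h7, ← Real.rpow_mul zero_le_two, ← Real.rpow_natCast]
    refine Real.rpow_le_rpow_of_exponent_le one_le_two ?_
    push_cast
    linarith
  set l := ⌈x / y⌉₊ with hl
  have hl1 : x / y ≤ l := Nat.le_ceil _
  have hl2 : (l : ℝ) ≤ 2 * (x / y) := by
    have := Nat.ceil_lt_add_one (show 0 ≤ x / y by positivity)
    linarith
  have hl0 : 0 < l := Nat.ceil_pos.2 (by positivity)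
  have hD : M ≤ (M / t + 1) * t := by
    rw [add_one_mul]
    exact (Nat.lt_div_mul_add htpos).le
  obtain ⟨C', hC', hsize⟩ := C.exists_size_le hC hCM hl0 hD
  refine ⟨C', hC', ?_⟩
  have hNQ : ((n + 1 : ℕ) : ℝ) ≤ Q * x := by
    have h7 : (n : ℝ) ≤ 1 / c * x := by
      rw [one_div, le_inv_mul_iff₀ hc]
      exact hcn
    push_cast
    rw [hQ]
    linarith
  have b0 : (C'.size : ℝ) ≤ _ := (Nat.cast_le.2 hsize).trans (chain_cost_le htpos htM)
  have b1 := chain_cost_lower_order (Nat.cast_nonneg (n + 1)) hNQ h1 hy1 hyx hw hl1 hl2 ht3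
  have b2 : (4 * Q + 15) * (x ^ 2 / y) ≤ e * (x ^ 2 / lam) := by
    rw [mul_div_assoc', mul_div_assoc', div_le_div_iff₀ hy0 hlam0]
    have h7 : (4 * Q + 15) * lam ≤ e * y := by
      rw [div_mul_eq_mul_div, div_le_iff₀ he0] at h6
      linarith
    have := mul_le_mul_of_nonneg_left h7 (sq_nonneg x)
    linarith
  have b3 := leading_term_le he0 he1 hx0 (Nat.cast_nonneg n) hlam0 ht2 htx h2
  have b4 : (1 / 2 + 20 * e) * (x * (x + 2 * n) / lam) ≤ (1 / 2 + ε) * (x * (x + 2 * n) / lam) := by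
    gcongr
  push_cast at b0 b1
  linarith

/-! ### Counting the functions with small circuits -/

/-- `w` is the output of a gate whose inputs carry functions from `A`. -/
def IsGateOutput {n : ℕ} (A : Set (BF n)) (w : BF n) : Prop :=
  w = 1 ∨ (∃ a ∈ A, ∃ b ∈ A, w = a + b) ∨ ∃ a ∈ A, ∃ b ∈ A, w = a * b

/-- The first `k` members of `h` are distinct, each is the output of a gate fed with variables and
earlier members, and `f` is a variable or one of them. -/
def IsDistinctChain {n : ℕ} (k : ℕ) (h : ℕ → BF n) (f : BF n) : Prop :=
  Set.InjOn h (Set.Iio k) ∧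
    (∀ j < k, IsGateOutput (Set.range inputFn ∪ h '' Set.Iio j) (h j)) ∧
    f ∈ Set.range inputFn ∪ h '' Set.Iio k

/-- Repeated node functions can be dropped from a gate sequence. -/
lemma XagGates.exists_isDistinctChain {n s : ℕ} (c : XagGates n s) :
    ∃ k ≤ s, ∃ h : ℕ → BF n, ∀ i, IsDistinctChain k h (c.fn i) := by
  suffices H : ∃ k ≤ s, ∃ h : ℕ → BF n, Set.InjOn h (Set.Iio k) ∧
      (∀ j < k, IsGateOutput (Set.range inputFn ∪ h '' Set.Iio j) (h j)) ∧
      ∀ i, c.fn i ∈ Set.range inputFn ∪ h '' Set.Iio k by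
    obtain ⟨k, hk, h, h1, h2, h3⟩ := H
    exact ⟨k, hk, h, fun i => ⟨h1, h2, h3 i⟩⟩
  induction c with
  | nil =>
    exact ⟨0, le_rfl, fun _ => 0, by simp, by simp, fun i => Or.inl ⟨i, rfl⟩⟩
  | @snoc s c g ih =>
    obtain ⟨k, hk, h, h1, h2, h3⟩ := ih
    by_cases hg : g.fn c.fn ∈ Set.range inputFn ∪ h '' Set.Iio k
    · refine ⟨k, by omega, h, h1, h2, fun i => ?_⟩
      rcases c.fn_snoc_cases g i with ⟨j, hj⟩ | hj
      · rw [hj]; exact h3 j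
      · rw [hj]; exact hg
    · have himg : ∀ j ≤ k, Function.update h k (g.fn c.fn) '' Set.Iio j = h '' Set.Iio j := by
        intro j hj
        refine Set.image_congr fun i hi => Function.update_of_ne ?_ _ _
        have : i < j := hi
        omega
      have hself : Function.update h k (g.fn c.fn) '' Set.Iio (k + 1) =
          insert (g.fn c.fn) (h '' Set.Iio k) := by
        have : Set.Iio (k + 1) = insert k (Set.Iio k) := by
          ext i
          simp only [Set.mem_Iio, Set.mem_insert_iff]
          omega
        rw [this, Set.image_insert_eq, Function.update_self, himg k le_rfl]
      refine ⟨k + 1, by omega, Function.update h k (g.fn c.fn), ?_, fun j hj => ?_, fun i => ?_⟩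
      · have hne : ∀ i, i < k → h i ≠ g.fn c.fn := fun i hi e => hg (Or.inr ⟨i, hi, e⟩)
        intro i hi j hj hij
        have hi' : i < k + 1 := hi
        have hj' : j < k + 1 := hj
        rcases Nat.lt_succ_iff_lt_or_eq.1 hi' with hi1 | rfl <;>
          rcases Nat.lt_succ_iff_lt_or_eq.1 hj' with hj1 | rfl
        · rw [Function.update_of_ne hi1.ne, Function.update_of_ne hj1.ne] at hij
          exact h1 hi1 hj1 hij
        · rw [Function.update_of_ne hi1.ne, Function.update_self] at hij
          exact absurd hij (hne i hi1)
        · rw [Function.update_of_ne hj1.ne, Function.update_self] at hij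
          exact absurd hij.symm (hne j hj1)
        · rfl
      · rw [himg j (by omega)]
        rcases Nat.lt_succ_iff_lt_or_eq.1 hj with hlt | rfl
        · rw [Function.update_of_ne hlt.ne]
          exact h2 j hlt
        · rw [Function.update_self]
          cases g with
          | one => exact Or.inl rfl
          | xorGate a b => exact Or.inr (Or.inl ⟨_, h3 a, _, h3 b, rfl⟩)
          | andGate a b => exact Or.inr (Or.inr ⟨_, h3 a, _, h3 b, rfl⟩)
      · rw [hself]
        rcases c.fn_snoc_cases g i with ⟨j, hj⟩ | hj
        · rw [hj]
          exact Set.union_subset_union_right _ (Set.subset_insert _ _) (h3 j)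
        · rw [hj]
          exact Or.inr (Or.inl rfl)

/-- A gate with inputs among labels of type `N`: `none` is the constant `1`, and the Boolean tells
conjunctions from sums. -/
abbrev GateCode (N : Type) : Type := Option (Bool × N × N)

/-- The output of a gate, given the functions carried by the labels. -/
def GateCode.eval {n : ℕ} {N : Type} (u : N → BF n) : GateCode N → BF n
  | none => 1
  | some (b, i, j) => if b then u i * u j else u i + u j

/-- The inputs of the gate are variables or gates whose rank is below `r`. -/
def GateCode.RanksBelow {A B : Type} (rank : B → ℕ) (r : ℕ) (g : GateCode (A ⊕ B)) : Prop :=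
  ∀ b i j, g = some (b, i, j) → ∀ k, i = Sum.inr k ∨ j = Sum.inr k → rank k < r

lemma GateCode.eval_congr {n : ℕ} {A B : Type} {rank : B → ℕ} {r : ℕ} {g : GateCode (A ⊕ B)}
    (hg : g.RanksBelow rank r) {v : A → BF n} {u u' : B → BF n}
    (hu : ∀ k, rank k < r → u k = u' k) :
    g.eval (Sum.elim v u) = g.eval (Sum.elim v u') := by
  rcases g with _ | ⟨b, i, j⟩
  · rfl
  · have key : ∀ x : A ⊕ B, (∀ k, x = Sum.inr k → rank k < r) →
        Sum.elim v u x = Sum.elim v u' x := by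
      rintro (x | x) hx
      · rfl
      · exact hu x (hx x rfl)
    simp only [GateCode.eval]
    rw [key i fun k hk => hg b i j rfl k (Or.inl hk), key j fun k hk => hg b i j rfl k (Or.inr hk)]

/-- An acyclic system of gates determines the functions at its gates, whatever their order. -/
lemma GateCode.eval_unique {n : ℕ} {A B : Type} {rank : B → ℕ} {q : B → GateCode (A ⊕ B)}
    (hq : ∀ k, (q k).RanksBelow rank (rank k)) {v : A → BF n} {u u' : B → BF n}
    (hu : ∀ k, u k = (q k).eval (Sum.elim v u)) (hu' : ∀ k, u' k = (q k).eval (Sum.elim v u')) :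
    u = u' := by
  have H : ∀ r k, rank k = r → u k = u' k := by
    intro r
    induction r using Nat.strong_induction_on with
    | _ r ih =>
      rintro k rfl
      rw [hu k, hu' k]
      exact GateCode.eval_congr (hq k) fun j hj => ih _ hj j rfl
  exact funext fun k => H _ k rfl

lemma IsGateOutput.exists_code {n : ℕ} {s : ℕ} {h : ℕ → BF n} (π : Equiv.Perm (Fin s)) {r : ℕ}
    (hr : r ≤ s) {w : BF n} (hw : IsGateOutput (Set.range inputFn ∪ h '' Set.Iio r) w) :
    ∃ g : GateCode (Fin n ⊕ Fin s), g.RanksBelow (fun k => (π k : ℕ)) r ∧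
      w = g.eval (Sum.elim inputFn fun k => h (π k)) := by
  have key : ∀ a ∈ Set.range inputFn ∪ h '' Set.Iio r, ∃ x : Fin n ⊕ Fin s,
      Sum.elim inputFn (fun k => h (π k)) x = a ∧ ∀ k, x = Sum.inr k → (π k : ℕ) < r := by
    rintro a (⟨i, rfl⟩ | ⟨j, hj, rfl⟩)
    · exact ⟨Sum.inl i, rfl, fun k hk => by cases hk⟩
    · have hj' : j < r := hj
      refine ⟨Sum.inr (π.symm ⟨j, by omega⟩), by simp, fun k hk => ?_⟩
      obtain rfl := Sum.inr.inj hk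
      simpa using hj'
  have mk : ∀ a ∈ Set.range inputFn ∪ h '' Set.Iio r, ∀ b ∈ Set.range inputFn ∪ h '' Set.Iio r,
      ∀ t : Bool, ∃ g : GateCode (Fin n ⊕ Fin s), g.RanksBelow (fun k => (π k : ℕ)) r ∧
        (if t then a * b else a + b) = g.eval (Sum.elim inputFn fun k => h (π k)) := by
    intro a ha b hb t
    obtain ⟨x, rfl, hx⟩ := key a ha
    obtain ⟨y, rfl, hy⟩ := key b hb
    refine ⟨some (t, x, y), ?_, rfl⟩
    rintro t' x' y' e k hk
    simp only [Option.some.injEq, Prod.mk.injEq] at e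
    obtain ⟨-, rfl, rfl⟩ := e
    exact hk.elim (hx k) (hy k)
  rcases hw with rfl | ⟨a, ha, b, hb, rfl⟩ | ⟨a, ha, b, hb, rfl⟩
  · exact ⟨none, fun b i j e => (nomatch e), rfl⟩
  · exact mk a ha b hb false
  · exact mk a ha b hb true

open Classical in
/-- The functions that have a chain of exactly `s` distinct gate functions. -/
noncomputable def chainFunctions (n s : ℕ) : Finset (BF n) :=
  Finset.univ.filter fun f => ∃ h, IsDistinctChain s h f

/-- Each function with a chain of `s` distinct gate functions has `s !` different descriptions as
an unordered system of labelled gates. -/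
lemma card_chainFunctions_mul_factorial_le (n s : ℕ) :
    (chainFunctions n s).card * s.factorial ≤ (1 + 2 * (n + s) ^ 2) ^ s * (n + s) := by
  classical
  have hdat : ∀ f : chainFunctions n s, ∃ h, IsDistinctChain s h f.1 := fun f =>
    (Finset.mem_filter.1 f.2).2
  choose h hinj hgate hf using hdat
  have hcode : ∀ (f : chainFunctions n s) (π : Equiv.Perm (Fin s)) (k : Fin s),
      ∃ g : GateCode (Fin n ⊕ Fin s), g.RanksBelow (fun k => (π k : ℕ)) (π k) ∧
        h f (π k) = g.eval (Sum.elim inputFn fun k => h f (π k)) := fun f π k =>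
    (hgate f (π k) (π k).2).exists_code π (π k).2.le
  choose q hq1 hq2 using hcode
  have hout : ∀ (f : chainFunctions n s) (π : Equiv.Perm (Fin s)), ∃ o : Fin n ⊕ Fin s,
      Sum.elim inputFn (fun k => h f (π k)) o = f.1 := by
    intro f π
    rcases hf f with ⟨i, hi⟩ | ⟨j, hj, hi⟩
    · exact ⟨Sum.inl i, hi⟩
    · exact ⟨Sum.inr (π.symm ⟨j, hj⟩), by simpa using hi⟩
  choose o ho using hout
  have hΦ : Function.Injective (fun p : chainFunctions n s × Equiv.Perm (Fin s) =>
      (q p.1 p.2, o p.1 p.2)) := by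
    rintro ⟨f, π⟩ ⟨g, ρ⟩ e
    simp only [Prod.mk.injEq] at e
    have hu : (fun k => h f (π k)) = fun k => h g (ρ k) :=
      GateCode.eval_unique (hq1 f π) (hq2 f π) (by rw [e.1]; exact hq2 g ρ)
    have hfg : f = g := by
      apply Subtype.ext
      rw [← ho f π, ← ho g ρ, hu, e.2]
    subst hfg
    refine Prod.ext rfl (Equiv.ext fun k => Fin.ext ?_)
    exact hinj f (π k).2 (ρ k).2 (congrFun hu k)
  have := Fintype.card_le_of_injective _ hΦ
  simp only [Fintype.card_prod, Fintype.card_coe, Fintype.card_perm, Fintype.card_fin,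
    Fintype.card_pi, Fintype.card_option, Fintype.card_bool, Fintype.card_sum, Finset.prod_const,
    Finset.card_univ] at this
  refine this.trans (le_of_eq ?_)
  ring

open Classical in
/-- The functions computed by circuits of size at most `L`. -/
noncomputable def smallFunctions (n L : ℕ) : Finset (BF n) :=
  Finset.univ.filter fun f => ∃ C : XagCircuit n, C.size ≤ L ∧ C.gates.fn C.output = f

/-- There are at most `(n + L) ^ (L + 2) * 16 ^ (n + L)` functions with circuits of size `L`. -/
lemma card_smallFunctions_le {n L : ℕ} (hn : 1 ≤ n) :
    ((smallFunctions n L).card : ℝ) ≤ ((n : ℝ) + L) ^ (L + 2) * 16 ^ (n + L) := by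
  classical
  have hsub : smallFunctions n L ⊆ (Finset.range (L + 1)).biUnion (chainFunctions n) := by
    intro f hf
    obtain ⟨C, hC, rfl⟩ := (Finset.mem_filter.1 hf).2
    obtain ⟨k, hk, h, hh⟩ := C.gates.exists_isDistinctChain
    exact Finset.mem_biUnion.2 ⟨k, Finset.mem_range.2 (by omega),
      Finset.mem_filter.2 ⟨Finset.mem_univ _, h, hh _⟩⟩
  have hn' : (1 : ℝ) ≤ n := by exact_mod_cast hn
  have hL0 : (0 : ℝ) ≤ L := Nat.cast_nonneg L
  have hterm : ∀ s ∈ Finset.range (L + 1), ((chainFunctions n s).card : ℝ) ≤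
      3 ^ (n + L) * ((n : ℝ) + L) ^ (L + 1) * Real.exp (n + L) := by
    intro s hs
    have hs' : s ≤ L := Nat.lt_succ_iff.1 (Finset.mem_range.1 hs)
    have hsL : (s : ℝ) ≤ L := by exact_mod_cast hs'
    have hs0 : (0 : ℝ) ≤ s := Nat.cast_nonneg s
    have h1 : ((chainFunctions n s).card : ℝ) * s.factorial ≤
        (1 + 2 * ((n : ℝ) + s) ^ 2) ^ s * (n + s) := by
      exact_mod_cast card_chainFunctions_mul_factorial_le n s
    have hfac : (0 : ℝ) < s.factorial := by exact_mod_cast s.factorial_pos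
    have h2 : 1 + 2 * ((n : ℝ) + s) ^ 2 ≤ 3 * (n + s) * (n + s) := by nlinarith
    have h3 := Real.pow_div_factorial_le_exp ((n : ℝ) + s) (by positivity) s
    calc ((chainFunctions n s).card : ℝ)
        ≤ (1 + 2 * ((n : ℝ) + s) ^ 2) ^ s * (n + s) / s.factorial := by rwa [le_div_iff₀ hfac]
      _ ≤ (3 * ((n : ℝ) + s) * (n + s)) ^ s * (n + s) / s.factorial := by gcongr
      _ = 3 ^ s * ((n : ℝ) + s) ^ (s + 1) * (((n : ℝ) + s) ^ s / s.factorial) := by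
          rw [mul_pow, mul_pow]
          ring
      _ ≤ 3 ^ (n + L) * ((n : ℝ) + L) ^ (L + 1) * Real.exp (n + L) := by
          have h4 : (3 : ℝ) ^ s ≤ 3 ^ (n + L) := pow_le_pow_right₀ (by norm_num) (by omega)
          have h5 : ((n : ℝ) + s) ^ (s + 1) ≤ ((n : ℝ) + L) ^ (L + 1) :=
            (pow_le_pow_left₀ (by positivity) (by linarith) _).trans
              (pow_le_pow_right₀ (by linarith) (by omega))
          have h6 : Real.exp ((n : ℝ) + s) ≤ Real.exp (n + L) :=
            Real.exp_le_exp.2 (by linarith)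
          have h7 := h3.trans h6
          gcongr
  have hexp : 3 ^ (n + L) * Real.exp ((n : ℝ) + L) ≤ 16 ^ (n + L) := by
    have h1 : Real.exp ((n : ℝ) + L) = Real.exp 1 ^ (n + L) := by
      rw [← Real.exp_nat_mul]
      push_cast
      rw [mul_one]
    rw [h1, ← mul_pow]
    have := Real.exp_one_lt_d9
    exact pow_le_pow_left₀ (by positivity) (by linarith) _
  calc ((smallFunctions n L).card : ℝ)
      ≤ ∑ s ∈ Finset.range (L + 1), ((chainFunctions n s).card : ℝ) := by
        exact_mod_cast (Finset.card_le_card hsub).trans Finset.card_biUnion_le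
    _ ≤ (L + 1) * (3 ^ (n + L) * ((n : ℝ) + L) ^ (L + 1) * Real.exp (n + L)) := by
        refine (Finset.sum_le_sum hterm).trans (le_of_eq ?_)
        simp
    _ = (L + 1) * ((n : ℝ) + L) ^ (L + 1) * (3 ^ (n + L) * Real.exp (n + L)) := by ring
    _ ≤ (n + L) * ((n : ℝ) + L) ^ (L + 1) * 16 ^ (n + L) := by
        have : (L : ℝ) + 1 ≤ n + L := by linarith
        gcongr
    _ = _ := by ring

/-! ### A large family of functions with few conjunctions -/

section Layered

variable {I : Type*} [AddCommGroup I] [Fintype I]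

/-- The gates of a layered circuit. The gate `(l, i)` of layer `c` multiplies the variable `s c i`,
modified by a linear form in the gates of lower layers, by the variable `s' c (i + l)`, modified in
the same way. The coefficients of the two linear forms are `p false c (l, i)` and
`p true c (l, i)`. -/
def layerGate (p : Bool → ℕ → I × I → ℕ → I × I → ZMod 2) (s s' : ℕ → I → ZMod 2) :
    ℕ → I × I → ZMod 2
  | c, k =>
    (s c k.2 + ∑ d : Fin c, ∑ k', p false c k d k' * layerGate p s s' d k') *
      (s' c (k.2 + k.1) + ∑ d : Fin c, ∑ k', p true c k d k' * layerGate p s s' d k')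
  termination_by c => c
  decreasing_by all_goals exact d.2

/-- The linear form in the gates of lower layers that enters the first (`b = false`) or second
(`b = true`) input of gate `k` of layer `c`. -/
def layerForm (p : Bool → ℕ → I × I → ℕ → I × I → ZMod 2) (s s' : ℕ → I → ZMod 2) (b : Bool)
    (c : ℕ) (k : I × I) : ZMod 2 :=
  ∑ d ∈ Finset.range c, ∑ k', p b c k d k' * layerGate p s s' d k'

/-- The output of the layered circuit: the variables `z c l` select the sum of the gates `(l, i)` of
layer `c`. -/
def layerOutput (p : Bool → ℕ → I × I → ℕ → I × I → ZMod 2) (T : ℕ) (s s' z : ℕ → I → ZMod 2) :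
    ZMod 2 :=
  ∑ c ∈ Finset.range T, ∑ l, z c l * ∑ i, layerGate p s s' c (l, i)

variable {p q : Bool → ℕ → I × I → ℕ → I × I → ZMod 2} {s s' t t' : ℕ → I → ZMod 2}

lemma layerGate_eq (c : ℕ) (k : I × I) :
    layerGate p s s' c k = (s c k.2 + layerForm p s s' false c k) *
      (s' c (k.2 + k.1) + layerForm p s s' true c k) := by
  rw [layerGate]
  simp only [layerForm, Finset.sum_range]

lemma layerForm_congr {c : ℕ}
    (h : ∀ d < c, ∀ k, layerGate p s s' d k = layerGate p t t' d k) (b : Bool) (k : I × I) :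
    layerForm p s s' b c k = layerForm p t t' b c k := by
  unfold layerForm
  refine Finset.sum_congr rfl fun d hd => Finset.sum_congr rfl fun k' _ => ?_
  rw [h d (Finset.mem_range.1 hd)]

lemma layerGate_congr (c : ℕ) (h : ∀ d ≤ c, s d = t d ∧ s' d = t' d) (k : I × I) :
    layerGate p s s' c k = layerGate p t t' c k := by
  induction c using Nat.strong_induction_on generalizing k with
  | _ c ih =>
    have hf := layerForm_congr (p := p) (c := c) fun d hd k' =>
      ih d hd (fun e he => h e (by omega)) k'
    rw [layerGate_eq, layerGate_eq, (h c le_rfl).1, (h c le_rfl).2, hf, hf]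

lemma layerGate_congr_param (c : ℕ)
    (h : ∀ e ≤ c, ∀ d < e, ∀ b k k', p b e k d k' = q b e k d k') (k : I × I) :
    layerGate p s s' c k = layerGate q s s' c k := by
  induction c using Nat.strong_induction_on generalizing k with
  | _ c ih =>
    have hf : ∀ b, layerForm p s s' b c k = layerForm q s s' b c k := by
      intro b
      refine Finset.sum_congr rfl fun d hd => Finset.sum_congr rfl fun k' _ => ?_
      have hd' := Finset.mem_range.1 hd
      rw [ih d hd' (fun e he => h e (by omega)), h c le_rfl d hd']
    rw [layerGate_eq, layerGate_eq, hf, hf]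

lemma layerGate_eq_zero (c : ℕ) (h : ∀ d ≤ c, s d = 0) (h' : ∀ d ≤ c, s' d = 0) (k : I × I) :
    layerGate p s s' c k = 0 := by
  induction c using Nat.strong_induction_on generalizing k with
  | _ c ih =>
    have hf : ∀ b, layerForm p s s' b c k = 0 := by
      intro b
      refine Finset.sum_eq_zero fun d hd => Finset.sum_eq_zero fun k' _ => ?_
      have hd' := Finset.mem_range.1 hd
      rw [ih d hd' (fun e he => h e (by omega)) (fun e he => h' e (by omega)), mul_zero]
    rw [layerGate_eq, hf, h c le_rfl]
    simp

variable [DecidableEq I]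

/-- The gates of the first `C` layers are linearly independent functions of the variables of these
layers. In the top layer the gates are separated by the products `s C i * s' C j`, one for each. -/
lemma layerGate_linearIndependent (C : ℕ) (γ : ℕ → I × I → ZMod 2)
    (h : ∀ s s' : ℕ → I → ZMod 2, (∀ c, C ≤ c → s c = 0 ∧ s' c = 0) →
      ∑ c ∈ Finset.range C, ∑ k, γ c k * layerGate p s s' c k = 0) :
    ∀ c < C, ∀ k, γ c k = 0 := by
  induction C with
  | zero => intro c hc; omega
  | succ C ih =>
    have top : ∀ k, γ C k = 0 := by
      rintro ⟨l, i⟩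
      have hs : ∀ j : I, ∀ d, d ≠ C → (Pi.single C (Pi.single j 1) : ℕ → I → ZMod 2) d = 0 :=
        fun j d hd => Pi.single_eq_of_ne hd _
      have h1 := h (Pi.single C (Pi.single i 1)) (Pi.single C (Pi.single (i + l) 1))
        fun c hc => ⟨hs i c (by omega), hs (i + l) c (by omega)⟩
      have hlow : ∀ d < C, ∀ k, layerGate p (Pi.single C (Pi.single i 1))
          (Pi.single C (Pi.single (i + l) 1)) d k = 0 := fun d hd k =>
        layerGate_eq_zero d (fun e he => hs i e (by omega)) (fun e he => hs (i + l) e (by omega)) k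
      have hform : ∀ b k, layerForm p (Pi.single C (Pi.single i 1))
          (Pi.single C (Pi.single (i + l) 1)) b C k = 0 := by
        intro b k
        refine Finset.sum_eq_zero fun d hd => Finset.sum_eq_zero fun k' _ => ?_
        rw [hlow d (Finset.mem_range.1 hd), mul_zero]
      rw [Finset.sum_range_succ, Finset.sum_eq_zero, zero_add,
        Fintype.sum_eq_single (l, i)] at h1
      · rw [layerGate_eq, hform, hform] at h1
        simpa using h1
      · rintro ⟨l', i'⟩ hne
        rw [layerGate_eq, hform, hform]
        simp only [Pi.single_eq_same, add_zero]
        by_cases hi : i' = i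
        · subst hi
          have hl : l' ≠ l := fun e => hne (by rw [e])
          have hne' : i' + l' ≠ i' + l := by simpa using hl
          simp [Pi.single_eq_of_ne hne']
        · rw [Pi.single_eq_of_ne hi]
          simp
      · intro d hd
        refine Finset.sum_eq_zero fun k' _ => ?_
        rw [hlow d (Finset.mem_range.1 hd), mul_zero]
    intro c hc
    rcases Nat.lt_succ_iff_lt_or_eq.1 hc with hlt | rfl
    · refine ih (fun s s' hs => ?_) c hlt
      have h1 := h s s' fun c hc => hs c (by omega)
      rw [Finset.sum_range_succ] at h1
      simpa [top] using h1
    · exact top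

lemma layerOutput_single {T c : ℕ} (hc : c < T) (l : I) :
    layerOutput p T s s' (Pi.single c (Pi.single l 1)) = ∑ i, layerGate p s s' c (l, i) := by
  unfold layerOutput
  rw [Finset.sum_eq_single c, Fintype.sum_eq_single l]
  · simp
  · intro l' hl
    simp [Pi.single_eq_of_ne hl]
  · intro d _ hd
    simp [Pi.single_eq_of_ne hd]
  · intro h
    exact absurd (Finset.mem_range.2 hc) h

/-- Setting the variable `s c i` or `s' c (i + l)` adds the other linear form of gate `(l, i)` to the
sum of the gates `(l, _)` of layer `c`. -/
lemma sum_layerGate_update {c : ℕ} (hs : s c = 0) (hs' : s' c = 0) (l i : I) (b : Bool) :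
    ∑ j, layerGate p (if b then Function.update s c (Pi.single i 1) else s)
        (if b then s' else Function.update s' c (Pi.single (i + l) 1)) c (l, j) =
      ∑ j, layerGate p s s' c (l, j) + layerForm p s s' b c (l, i) := by
  have hform : ∀ b' k, layerForm p (if b then Function.update s c (Pi.single i 1) else s)
      (if b then s' else Function.update s' c (Pi.single (i + l) 1)) b' c k =
        layerForm p s s' b' c k := by
    intro b' k
    refine layerForm_congr (fun d hd k' => layerGate_congr d (fun e he => ?_) k') b' k
    have : e ≠ c := by omega
    cases b <;> simp [Function.update_of_ne this]
  have e1 : layerForm p s s' b c (l, i) =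
      ∑ j, (Pi.single i 1 : I → ZMod 2) j * layerForm p s s' b c (l, j) := by
    rw [Fintype.sum_eq_single i fun j hj => by simp [Pi.single_eq_of_ne hj]]
    simp
  rw [e1, ← Finset.sum_add_distrib]
  refine Finset.sum_congr rfl fun j _ => ?_
  have e2 : (Pi.single (i + l) 1 : I → ZMod 2) (j + l) = (Pi.single i 1 : I → ZMod 2) j := by
    simp [Pi.single_apply]
  rw [layerGate_eq, layerGate_eq, hform, hform, hs, hs']
  cases b
  · simp only [Bool.false_eq_true, if_false, hs, Function.update_self, e2, Pi.zero_apply]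
    ring
  · simp only [if_true, hs', Function.update_self, Pi.zero_apply]
    ring

/-- The output determines the coefficients of a layered circuit. By induction on the layer, the lower
gates are known; the linear forms of a gate are obtained from the output by differences, and the
independence of the lower gates gives their coefficients. -/
lemma layerOutput_injective {T : ℕ}
    (h : ∀ s s' z : ℕ → I → ZMod 2, (∀ c, T ≤ c → s c = 0 ∧ s' c = 0 ∧ z c = 0) →
      layerOutput p T s s' z = layerOutput q T s s' z) :
    ∀ c < T, ∀ d < c, ∀ b k k', p b c k d k' = q b c k d k' := by
  intro c
  induction c using Nat.strong_induction_on with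
  | _ c ih =>
    intro hc d hd b k k'
    obtain ⟨l, i⟩ := k
    have hgate : ∀ e < c, ∀ (s s' : ℕ → I → ZMod 2) k,
        layerGate p s s' e k = layerGate q s s' e k := fun e he s s' k =>
      layerGate_congr_param e (fun e' he' d hd b k k' => ih e' (by omega) (by omega) d hd b k k') k
    have hz : ∀ e, T ≤ e → (Pi.single c (Pi.single l 1) : ℕ → I → ZMod 2) e = 0 :=
      fun e he => Pi.single_eq_of_ne (by omega) _
    have hform : ∀ s s' : ℕ → I → ZMod 2, (∀ e, c ≤ e → s e = 0 ∧ s' e = 0) →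
        layerForm p s s' b c (l, i) = layerForm q s s' b c (l, i) := by
      intro s s' hs
      have h0 := h s s' (Pi.single c (Pi.single l 1)) fun e he =>
        ⟨(hs e (by omega)).1, (hs e (by omega)).2, hz e he⟩
      have h1 := h (if b then Function.update s c (Pi.single i 1) else s)
        (if b then s' else Function.update s' c (Pi.single (i + l) 1))
        (Pi.single c (Pi.single l 1)) fun e he => by
          have hec : e ≠ c := by omega
          refine ⟨?_, ?_, hz e he⟩ <;> cases b <;>
            simp [Function.update_of_ne hec, hs e (by omega)]
      rw [layerOutput_single hc, layerOutput_single hc] at h0 h1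
      rw [sum_layerGate_update (hs c le_rfl).1 (hs c le_rfl).2,
        sum_layerGate_update (hs c le_rfl).1 (hs c le_rfl).2, h0] at h1
      exact add_left_cancel h1
    have := layerGate_linearIndependent (p := p) c
      (fun e k' => p b c (l, i) e k' - q b c (l, i) e k') (fun s s' hs => by
        have h1 := hform s s' hs
        unfold layerForm at h1
        rw [← sub_eq_zero, ← Finset.sum_sub_distrib] at h1
        rw [← h1]
        refine Finset.sum_congr rfl fun e he => ?_
        rw [← Finset.sum_sub_distrib]
        refine Finset.sum_congr rfl fun k' _ => ?_
        rw [sub_mul, hgate e (Finset.mem_range.1 he)]) d hd k'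
    exact sub_eq_zero.1 this

end Layered

namespace Realized

variable {n m : ℕ} {S : Set (BF n)}

lemma insert_of_mem_span (h : ∃ s, Realized s m S) (h0 : (0 : BF n) ∈ S) {a : BF n}
    (ha : a ∈ Submodule.span (ZMod 2) S) : ∃ s, Realized s m (insert a S) := by
  obtain ⟨s, h⟩ := h
  have hS : (id '' (S.toFinite.toFinset : Set (BF n))) = S := by simp
  rw [← hS] at ha
  obtain ⟨R, hR, rfl⟩ := exists_finset_sum_of_mem_span id _ ha
  exact ⟨_, h.sum h0 R id fun i hi => by simpa using hR hi⟩

/-- Products of linear combinations of known functions cost one conjunction each. -/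
lemma union_image_of_mul {ι : Type*} (h : ∃ s, Realized s m S) (h0 : (0 : BF n) ∈ S)
    (u : Finset ι) (t : ι → BF n)
    (ht : ∀ i ∈ u, ∃ a ∈ Submodule.span (ZMod 2) S, ∃ b ∈ Submodule.span (ZMod 2) S,
      t i = a * b) : ∃ s, Realized s (m + u.card) (S ∪ t '' u) := by
  classical
  induction u using Finset.induction_on with
  | empty => simpa using h
  | insert i u hi ih =>
    have h1 := ih fun j hj => ht j (Finset.mem_insert_of_mem hj)
    obtain ⟨a, ha, b, hb, hab⟩ := ht i (Finset.mem_insert_self _ _)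
    have h2 := insert_of_mem_span h1 (Or.inl h0) (Submodule.span_mono Set.subset_union_left ha)
    obtain ⟨s, h3⟩ := insert_of_mem_span h2 (Or.inr (Or.inl h0))
      (Submodule.span_mono (Set.subset_union_left.trans (Set.subset_insert _ _)) hb)
    have h4 := h3.mul (f := a) (g := b) (Or.inr (Or.inl rfl)) (Or.inl rfl)
    refine ⟨_, h4.mono le_rfl ?_ ?_⟩
    · rw [Finset.card_insert_of_notMem hi]
      omega
    · rw [Finset.coe_insert, Set.image_insert_eq, Set.union_insert, hab]
      exact Set.insert_subset_insert ((Set.subset_insert _ _).trans (Set.subset_insert _ _))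

end Realized

section Embedded

variable {I : Type*} [AddCommGroup I] [Fintype I] {n T : ℕ}

/-- The variables of kind `a` of a layered circuit, read off from `n` variables. -/
def layerVar (e : Fin 3 × Fin T × I → Fin n) (a : Fin 3) (x : Fin n → Bool) (c : ℕ) (i : I) :
    ZMod 2 :=
  if h : c < T then bitVal (x (e (a, ⟨c, h⟩, i))) else 0

/-- The function of `n` variables computed by a layered circuit. -/
def layerFn (p : Bool → ℕ → I × I → ℕ → I × I → ZMod 2) (e : Fin 3 × Fin T × I → Fin n) : BF n :=
  fun x => layerOutput p T (layerVar e 0 x) (layerVar e 1 x) (layerVar e 2 x)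

lemma layerFn_realized (p : Bool → ℕ → I × I → ℕ → I × I → ZMod 2)
    (e : Fin 3 × Fin T × I → Fin n) :
    ∃ s, Realized s (T * (Fintype.card I) ^ 2 + T * Fintype.card I) {layerFn p e} := by
  set var : Fin 3 → ℕ → I → BF n := fun a c i x => layerVar e a x c i with hvar
  set g : ℕ → I × I → BF n := fun c k x => layerGate p (layerVar e 0 x) (layerVar e 1 x) c k
    with hg
  set base : Set (BF n) := insert 0 (insert 1 (Set.range inputFn)) with hbase
  set lower : ℕ → Set (BF n) := fun c => {f | ∃ d < c, ∃ k, f = g d k} with hlower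
  have hv : ∀ a c i, var a c i ∈ base := by
    intro a c i
    by_cases h : c < T
    · refine Or.inr (Or.inr ⟨e (a, ⟨c, h⟩, i), ?_⟩)
      funext x
      simp [hvar, layerVar, h, inputFn]
    · refine Or.inl ?_
      funext x
      simp [hvar, layerVar, h]
  have hlayers : ∀ c, ∃ s, Realized s (c * (Fintype.card I) ^ 2) (base ∪ lower c) := by
    intro c
    induction c with
    | zero =>
      refine ⟨_, (Realized.inputs.one.zero (Set.mem_insert _ _)).mono le_rfl (by simp) ?_⟩
      rintro f (hf | ⟨d, hd, -⟩)
      · exact hf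
      · omega
    | succ c ih =>
      have hlin : ∀ b k, (fun x => layerForm p (layerVar e 0 x) (layerVar e 1 x) b c k) ∈
          Submodule.span (ZMod 2) (base ∪ lower c) := by
        intro b k
        have : (fun x => layerForm p (layerVar e 0 x) (layerVar e 1 x) b c k) =
            ∑ d ∈ Finset.range c, ∑ k', p b c k d k' • g d k' := by
          funext x
          simp [layerForm, hg, Finset.sum_apply]
        rw [this]
        exact Submodule.sum_mem _ fun d hd => Submodule.sum_mem _ fun k' _ =>
          Submodule.smul_mem _ _ (Submodule.subset_span
            (Or.inr ⟨d, Finset.mem_range.1 hd, k', rfl⟩))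
      obtain ⟨s, hs⟩ := Realized.union_image_of_mul ih (Or.inl (Or.inl rfl)) Finset.univ (g c)
        fun k _ => ⟨_, Submodule.add_mem _ (Submodule.subset_span (Or.inl (hv 0 c k.2)))
          (hlin false k), _, Submodule.add_mem _
          (Submodule.subset_span (Or.inl (hv 1 c (k.2 + k.1)))) (hlin true k), by
            funext x
            exact layerGate_eq c k⟩
      refine ⟨s, hs.mono le_rfl (le_of_eq ?_) ?_⟩
      · rw [Finset.card_univ, Fintype.card_prod]
        ring
      · rintro f (hf | ⟨d, hd, k, rfl⟩)
        · exact Or.inl (Or.inl hf)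
        · rcases Nat.lt_succ_iff_lt_or_eq.1 hd with hlt | rfl
          · exact Or.inl (Or.inr ⟨d, hlt, k, rfl⟩)
          · exact Or.inr ⟨k, by simp, rfl⟩
  have hprod := Realized.union_image_of_mul (hlayers T) (Or.inl (Or.inl rfl))
    (Finset.range T ×ˢ (Finset.univ : Finset I)) (fun j => var 2 j.1 j.2 * ∑ i, g j.1 (j.2, i))
    fun j hj => ⟨_, Submodule.subset_span (Or.inl (hv 2 j.1 j.2)), _,
      Submodule.sum_mem _ fun i _ => Submodule.subset_span (Or.inr
        ⟨j.1, Finset.mem_range.1 (Finset.mem_product.1 hj).1, (j.2, i), rfl⟩), rfl⟩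
  have hout : layerFn p e ∈ Submodule.span (ZMod 2) ((base ∪ lower T) ∪
      (fun j : ℕ × I => var 2 j.1 j.2 * ∑ i, g j.1 (j.2, i)) ''
        (Finset.range T ×ˢ (Finset.univ : Finset I) : Finset (ℕ × I))) := by
    have : layerFn p e = ∑ j ∈ Finset.range T ×ˢ (Finset.univ : Finset I),
        var 2 j.1 j.2 * ∑ i, g j.1 (j.2, i) := by
      rw [Finset.sum_product]
      funext x
      simp [layerFn, layerOutput, hg, hvar, Finset.sum_apply]
    rw [this]
    exact Submodule.sum_mem _ fun j hj => Submodule.subset_span (Or.inr ⟨j, hj, rfl⟩)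
  obtain ⟨s, hs⟩ := Realized.insert_of_mem_span hprod (Or.inl (Or.inl (Or.inl rfl))) hout
  refine ⟨s, hs.mono le_rfl (le_of_eq ?_) (Set.singleton_subset_iff.2 (Set.mem_insert _ _))⟩
  rw [Finset.card_product, Finset.card_range, Finset.card_univ]

/-- The positions of the coefficients of a layered circuit with `T` layers: the layer and number of a
gate, the choice between its two linear forms, and a gate of a lower layer. -/
abbrev CoeffIndex (I : Type*) (T : ℕ) : Type _ := Σ c : Fin T, Bool × (I × I) × Fin c × (I × I)

/-- The coefficients with given values, extended by zero. -/
def extendCoeff (v : CoeffIndex I T → ZMod 2) :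
    Bool → ℕ → I × I → ℕ → I × I → ZMod 2 :=
  fun b c k d k' => if h : c < T ∧ d < c then v ⟨⟨c, h.1⟩, b, k, ⟨d, h.2⟩, k'⟩ else 0

lemma layerFn_extendCoeff_injective [DecidableEq I] {e : Fin 3 × Fin T × I → Fin n} (he : Function.Injective e) :
    Function.Injective fun v : CoeffIndex I T → ZMod 2 => layerFn (extendCoeff v) e := by
  intro v w hvw
  have H := layerOutput_injective (p := extendCoeff v) (q := extendCoeff w) (T := T) (by
    intro s s' z hsz
    -- The assignment of the `n` variables that induces `s`, `s'` and `z`.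
    set σ : Fin 3 → ℕ → I → ZMod 2 := ![s, s', z] with hσ
    set x : Fin n → Bool := Function.extend e (fun a => decide (σ a.1 a.2.1 a.2.2 = 1))
      fun _ => false with hx
    have hvar : ∀ a, layerVar e a x = σ a := by
      intro a
      funext c i
      by_cases hc : c < T
      · have hb : ∀ y : ZMod 2, bitVal (decide (y = 1)) = y := by decide
        simp only [layerVar, hc, dite_true, hx]
        rw [he.extend_apply]
        exact hb _
      · simp only [layerVar, hc, dite_false]
        obtain ⟨h1, h2, h3⟩ := hsz c (not_lt.1 hc)
        fin_cases a <;> simp [hσ, h1, h2, h3]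
    have := congrFun hvw x
    simp only [layerFn, hvar] at this
    exact this)
  funext ⟨c, b, k, d, k'⟩
  have h1 := H c c.2 d d.2 b k k'
  simpa [extendCoeff] using h1

end Embedded

/-- With `3 * T * B` variables, `T * B ^ 2 + T * B` conjunctions suffice for
`2 ^ (B ^ 4 * (T * (T - 1)))` functions. -/
lemma exists_large_family {n T B : ℕ} (hB : 1 ≤ B) (hn : 3 * T * B ≤ n) :
    ∃ F : Finset (BF n), F.card = 2 ^ (B ^ 4 * (T * (T - 1))) ∧
      ∀ f ∈ F, ∃ s, Realized s (T * B ^ 2 + T * B) {f} := by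
  classical
  have : NeZero B := ⟨by omega⟩
  obtain ⟨e⟩ : Nonempty (Fin 3 × Fin T × ZMod B ↪ Fin n) := by
    refine Function.Embedding.nonempty_of_card_le ?_
    simp only [Fintype.card_prod, Fintype.card_fin, ZMod.card]
    linarith [mul_assoc 3 T B]
  let _ : Fintype (CoeffIndex (ZMod B) T → ZMod 2) := Pi.instFintype
  refine ⟨Finset.univ.image fun v : CoeffIndex (ZMod B) T → ZMod 2 => layerFn (extendCoeff v) e,
    ?_, ?_⟩
  · rw [Finset.card_image_of_injective _ (layerFn_extendCoeff_injective e.injective),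
      Finset.card_univ, Fintype.card_fun, ZMod.card]
    congr 1
    simp only [Fintype.card_sigma, Fintype.card_prod, Fintype.card_bool, ZMod.card,
      Fintype.card_fin]
    rw [Finset.sum_fin_eq_sum_range]
    rw [← Finset.sum_range_id_mul_two, Finset.sum_mul, Finset.mul_sum]
    refine Finset.sum_congr rfl fun c hc => ?_
    rw [dif_pos (Finset.mem_range.1 hc)]
    ring
  · intro f hf
    obtain ⟨v, -, rfl⟩ := Finset.mem_image.1 hf
    have := layerFn_realized (extendCoeff v) e
    rwa [ZMod.card] at this

/-! ### Optimality of the upper bound -/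

/-- The bound `x * (x + 2 * n) / log₂ x` is increasing in `x`. -/
lemma size_bound_mono {x y n : ℝ} (hn : 0 ≤ n) (hx : 3 ≤ x) (hxy : x ≤ y) :
    x * (x + 2 * n) / Real.logb 2 x ≤ y * (y + 2 * n) / Real.logb 2 y := by
  have he : Real.exp 1 ≤ x := by
    have := Real.exp_one_lt_d9
    linarith
  have hlx : 0 < Real.logb 2 x := Real.logb_pos one_lt_two (by linarith)
  have hly : 0 < Real.logb 2 y := Real.logb_pos one_lt_two (by linarith)
  have h := Real.log_div_self_antitoneOn he (he.trans hxy) hxy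
  have h' : x / Real.logb 2 x ≤ y / Real.logb 2 y := by
    rw [div_le_div_iff₀ (by linarith) (by linarith)] at h
    rw [div_le_div_iff₀ hlx hly]
    simp only [Real.logb, mul_div_assoc']
    exact div_le_div_of_nonneg_right (by linarith) (Real.log_pos one_lt_two).le
  have hy0 : 0 ≤ y / Real.logb 2 y := by
    have : 0 ≤ y := by linarith
    positivity
  calc x * (x + 2 * n) / Real.logb 2 x = x / Real.logb 2 x * (x + 2 * n) := by ring
    _ ≤ y / Real.logb 2 y * (y + 2 * n) := by
        have : 0 ≤ x + 2 * n := by linarith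
        gcongr
    _ = _ := by ring

/-- The arithmetic behind the comparison of circuits with layered functions. Here `v = τ * b ^ 2` and
`a = τ * b` for `τ` layers of width `b`, and `v ^ 2 * (1 - ε)` is a lower bound for the number of
free coefficients. -/
lemma code_length_lt {a v ν μ ℓ lam ε : ℝ} (hε : 0 < ε) (hε1 : ε ≤ 1 / 4) (ha : 1 ≤ a)
    (hav : 320 * a ≤ ε * v) (hμ : μ = v + a) (hν0 : 0 ≤ ν) (hν : ν ≤ 4 * a) (hℓ0 : 0 ≤ ℓ)
    (hlam : 40 ≤ ε * lam) (hlamμ : lam ≤ 2 * μ)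
    (hL : ℓ * lam ≤ (1 / 2 - ε) * (μ * (μ + 2 * ν))) :
    ν + ℓ ≤ μ ^ 2 ∧ 2 * lam * (ℓ + 2) + 4 * (ν + ℓ) < v ^ 2 * (1 - ε) := by
  have hv0 : 0 < v := by
    by_contra hneg
    nlinarith
  have hεv : ε * v ≤ 1 / 4 * v := by gcongr
  have hlam0 : 160 ≤ lam := by
    by_contra hneg
    nlinarith
  have hμ0 : 1 ≤ μ := by linarith
  have hνμ : 2 * ν ≤ μ := by linarith
  have h1 : μ ≤ (1 + ε / 10) * v := by linarith
  have h2 : μ + 2 * ν ≤ (1 + ε / 10) * v := by linarith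
  have h3 : μ * (μ + 2 * ν) ≤ (1 + ε / 4) * v ^ 2 := by
    calc μ * (μ + 2 * ν) ≤ ((1 + ε / 10) * v) * ((1 + ε / 10) * v) := by gcongr
      _ = (1 + ε / 10) ^ 2 * v ^ 2 := by ring
      _ ≤ (1 + ε / 4) * v ^ 2 := by
        gcongr
        nlinarith
  have hX0 : 0 ≤ μ * (μ + 2 * ν) := by positivity
  constructor
  · have h4 : μ * (μ + 2 * ν) ≤ μ * (2 * μ) := by gcongr; linarith
    have h5 : (1 / 2 - ε) * (μ * (μ + 2 * ν)) ≤ 1 / 2 * (μ * (μ + 2 * ν)) := by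
      gcongr
      linarith
    have h6 : ℓ * 160 ≤ ℓ * lam := by gcongr
    have h7 : μ * 1 ≤ μ * μ := by gcongr
    have h8 : μ ^ 2 = μ * μ := sq μ
    linarith
  · have h4 : (1 - 2 * ε) * (μ * (μ + 2 * ν)) ≤ (1 - 2 * ε) * ((1 + ε / 4) * v ^ 2) := by
      have : 0 ≤ 1 - 2 * ε := by linarith
      gcongr
    have h5 : (1 - 2 * ε) * (1 + ε / 4) ≤ 1 - 3 / 2 * ε := by nlinarith
    have h6 : (1 - 2 * ε) * (1 + ε / 4) * v ^ 2 ≤ (1 - 3 / 2 * ε) * v ^ 2 := by gcongr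
    have h7 : 2 * lam * ℓ ≤ (1 - 3 / 2 * ε) * v ^ 2 := by linarith
    have hv2 : 0 < v ^ 2 := by positivity
    have h8 : 4 * ℓ ≤ ε / 10 * v ^ 2 := by
      have h9 : ℓ * 40 ≤ ℓ * (ε * lam) := by gcongr
      have h10 : lam * ℓ ≤ v ^ 2 := by
        have : 0 < ε * v ^ 2 := by positivity
        linarith
      have h11 : ε * (lam * ℓ) ≤ ε * v ^ 2 := by gcongr
      linarith
    have h9 : 4 * lam + 4 * ν ≤ ε / 10 * v ^ 2 := by
      have h10 : v * 200 ≤ v * (ε * v) := by gcongr; linarith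
      have h11 : ε / 10 * v ^ 2 = v * (ε * v) / 10 := by ring
      linarith
    have h10 : 0 < ε * v ^ 2 := by positivity
    linarith

/-- The layered circuits of width `B` outnumber the functions of size at most `L`, if `L` lies below
the bound by a factor `1 - 2 * ε` and the number `T` of layers is at least `1 / ε`. -/
lemma small_count_lt {T B n L M : ℕ} {ε : ℝ} (hε : 0 < ε) (hε1 : ε ≤ 1 / 4)
    (hM : M = T * B ^ 2 + T * B) (hT : 1 / ε ≤ T) (hn : n ≤ 3 * T * (B + 1))
    (hB : 320 / ε ≤ B) (hlog : 40 / ε ≤ Real.logb 2 (M : ℝ))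
    (hL : (L : ℝ) ≤ (1 / 2 - ε) * ((M : ℝ) * (M + 2 * n) / Real.logb 2 (M : ℝ))) :
    ((n : ℝ) + L) ^ (L + 2) * 16 ^ (n + L) < 2 ^ (B ^ 4 * (T * (T - 1))) := by
  set lam := Real.logb 2 (M : ℝ) with hlam
  have hlam0 : 0 < lam := lt_of_lt_of_le (by positivity) hlog
  have hT' : 1 ≤ ε * T := by rwa [div_le_iff₀' hε] at hT
  have hB' : 320 ≤ ε * B := by rwa [div_le_iff₀' hε] at hB
  have hlam' : 40 ≤ ε * lam := by rwa [div_le_iff₀' hε] at hlog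
  have hT0 : (0 : ℝ) < T := lt_of_lt_of_le (by positivity) hT
  have hT1 : 1 ≤ T := by exact_mod_cast hT0
  have hT1' : (1 : ℝ) ≤ T := by exact_mod_cast hT1
  have hB0 : (0 : ℝ) < B := lt_of_lt_of_le (by positivity) hB
  have hB3 : (3 : ℝ) ≤ B := by
    by_contra hneg
    nlinarith
  have hn' : (n : ℝ) ≤ 3 * T * (B + 1) := by exact_mod_cast hn
  have hM' : (M : ℝ) = T * B ^ 2 + T * B := by exact_mod_cast hM
  have hTB : (T : ℝ) * 3 ≤ T * B := by gcongr
  have hM0 : (0 : ℝ) < M := by rw [hM']; positivity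
  have hlamM : lam ≤ 2 * M := by
    rw [hlam, Real.logb, div_le_iff₀ (Real.log_pos one_lt_two)]
    have h4 := Real.log_le_sub_one_of_pos hM0
    have h5 := Real.log_two_gt_d9
    have h6 : (M : ℝ) * (1 / 2) ≤ M * Real.log 2 := by gcongr; linarith
    linarith
  obtain ⟨hsum, hlen⟩ := code_length_lt (a := T * B) (v := T * B ^ 2) (ν := n) (μ := M) (ℓ := L)
    hε hε1 (by linarith)
    (by
      have : (T : ℝ) * B * 320 ≤ T * B * (ε * B) := by gcongr
      linarith)
    hM' (Nat.cast_nonneg n) (by linarith) (Nat.cast_nonneg L) hlam' hlamM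
    (by rwa [mul_div_assoc', le_div_iff₀ hlam0] at hL)
  have hexp : 2 * lam * ((L : ℝ) + 2) + 4 * ((n : ℝ) + L) <
      ((B ^ 4 * (T * (T - 1)) : ℕ) : ℝ) := by
    refine hlen.trans_le ?_
    push_cast [Nat.cast_sub hT1]
    have h12 : (T : ℝ) * B ^ 4 * 1 ≤ T * B ^ 4 * (ε * T) := by gcongr
    linarith
  have hμlam : (M : ℝ) = 2 ^ lam := (Real.rpow_logb two_pos (by norm_num) hM0).symm
  calc ((n : ℝ) + L) ^ (L + 2) * 16 ^ (n + L) ≤ ((M : ℝ) ^ 2) ^ (L + 2) * 16 ^ (n + L) := by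
        gcongr
    _ = (2 : ℝ) ^ (2 * lam * ((L : ℝ) + 2) + 4 * ((n : ℝ) + L)) := by
        rw [Real.rpow_add two_pos]
        congr 1
        · rw [hμlam, ← pow_mul, ← Real.rpow_natCast, ← Real.rpow_mul zero_le_two]
          congr 1
          push_cast
          ring
        · rw [show (16 : ℝ) = 2 ^ 4 by norm_num, ← pow_mul, ← Real.rpow_natCast]
          congr 1
          push_cast
          ring
    _ < (2 : ℝ) ^ ((B ^ 4 * (T * (T - 1)) : ℕ) : ℝ) :=
        Real.rpow_lt_rpow_of_exponent_lt one_lt_two hexp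
    _ = _ := Real.rpow_natCast _ _

/-- Among the functions of layered circuits with `M` conjunctions there is one all of whose circuits
have size almost `M * (M + 2 * n) / (2 * log₂ M)`. -/
lemma exists_hard_function {T B n M : ℕ} {ε : ℝ} (hε : 0 < ε) (hε1 : ε ≤ 1 / 4)
    (hM : M = T * B ^ 2 + T * B) (hT : 1 / ε ≤ T) (hn1 : 1 ≤ n) (hn2 : 3 * T * B ≤ n)
    (hn : n ≤ 3 * T * (B + 1)) (hB : 320 / ε ≤ B) (hlog : 40 / ε ≤ Real.logb 2 (M : ℝ)) :
    ∃ f : (Fin n → Bool) → Bool, (∃ C : XagCircuit n, C.Computes f ∧ C.andCount ≤ M) ∧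
      ∀ C : XagCircuit n, C.Computes f →
        (1 / 2 - ε) * ((M : ℝ) * (M + 2 * n) / Real.logb 2 (M : ℝ)) < C.size := by
  classical
  have hB1 : 1 ≤ B := by
    have : (0 : ℝ) < B := lt_of_lt_of_le (by positivity) hB
    exact_mod_cast this
  obtain ⟨F, hcard, hF⟩ := exists_large_family hB1 hn2
  set Y := (1 / 2 - ε) * ((M : ℝ) * (M + 2 * n) / Real.logb 2 (M : ℝ)) with hY
  have hlog0 : 0 < Real.logb 2 (M : ℝ) := lt_of_lt_of_le (by positivity) hlog
  have hY0 : 0 ≤ Y := by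
    have : 0 ≤ 1 / 2 - ε := by linarith
    positivity
  have hlt : (smallFunctions n ⌊Y⌋₊).card < F.card := by
    have h1 := (card_smallFunctions_le (L := ⌊Y⌋₊) hn1).trans_lt
      (small_count_lt hε hε1 hM hT hn hB hlog (Nat.floor_le hY0))
    rw [hcard]
    exact_mod_cast h1
  obtain ⟨w, hwF, hw⟩ := Finset.exists_mem_notMem_of_card_lt_card hlt
  have hbit : ∀ y : ZMod 2, bitVal (decide (y = 1)) = y := by decide
  have hfw : (fun x => bitVal (decide (w x = 1))) = w := funext fun x => hbit (w x)
  refine ⟨fun x => decide (w x = 1), ?_, fun C hC => ?_⟩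
  · obtain ⟨s, hs⟩ := hF w hwF
    obtain ⟨C, hC, -, hand⟩ := hs.exists_circuit (fun x => decide (w x = 1)) hfw
    exact ⟨C, hC, hand.trans_eq hM.symm⟩
  · rw [← Nat.floor_lt hY0]
    by_contra hle
    refine hw (Finset.mem_filter.2 ⟨Finset.mem_univ _, C, not_lt.1 hle, ?_⟩)
    rw [← hfw]
    exact funext fun x => congrArg bitVal (hC x)

/-- Some function with a multiplicative complexity of at least `K * n` has no circuit substantially
smaller than the upper bound. Its multiplicative complexity is large because otherwise the upper
bound itself would give a circuit of size `O(n ^ 2)`. -/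
theorem exists_function_of_large_size (K : ℝ) (hK : 0 < K) (ε : ℝ) (hε : 0 < ε)
    (hε1 : ε ≤ 1 / 4) :
    ∃ n₀ : ℕ, ∀ n : ℕ, n₀ ≤ n →
      ∃ (f : (Fin n → Bool) → Bool) (M : ℕ), HasMultComplexity f M ∧ K * (n : ℝ) ≤ (M : ℝ) ∧
        ∀ C : XagCircuit n, C.Computes f →
          (1 / 2 - ε) * ((M : ℝ) * ((M : ℝ) + 2 * (n : ℝ)) / Real.logb 2 (M : ℝ)) ≤
            (C.size : ℝ) := by
  obtain ⟨M₀, hM₀⟩ := exists_small_circuit K hK (1 / 2) (by norm_num)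
  set T := ⌈1 / ε⌉₊ with hTdef
  have hT : 1 / ε ≤ T := Nat.le_ceil _
  have hT0 : 0 < T := Nat.ceil_pos.2 (by positivity)
  set c₀ : ℝ := 144 * T * ((K + 1) * (K + 3)) with hc₀
  have hev : ∀ᶠ x : ℝ in Filter.atTop, 40 / ε ≤ Real.logb 2 x ∧ c₀ * Real.logb 2 x ≤ x := by
    filter_upwards [(Real.tendsto_logb_atTop one_lt_two).eventually_ge_atTop (40 / ε),
      eventually_mul_logb_le_rpow c₀ 1 one_pos] with x h1 h2
    exact ⟨h1, by rwa [Real.rpow_one] at h2⟩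
  obtain ⟨x₀, hx₀⟩ := Filter.eventually_atTop.1 hev
  set B₀ := ⌈max x₀ (320 / ε)⌉₊ with hB₀
  set k₀ := ⌈max (3 : ℝ) M₀ / K⌉₊ with hk₀
  refine ⟨max (max (3 * T * B₀) k₀) 1, fun n hn => ?_⟩
  have hn1 : 1 ≤ n := (le_max_right _ _).trans hn
  have hnB : 3 * T * B₀ ≤ n := ((le_max_left _ _).trans (le_max_left _ _)).trans hn
  have hnk : k₀ ≤ n := ((le_max_right _ _).trans (le_max_left _ _)).trans hn
  have hKn : max (3 : ℝ) M₀ ≤ K * n := by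
    have h1 : max (3 : ℝ) M₀ / K ≤ n := (Nat.le_ceil _).trans (Nat.cast_le.2 hnk)
    rwa [div_le_iff₀' hK] at h1
  have hK3 : 3 ≤ K * n := (le_max_left _ _).trans hKn
  have hKM : (M₀ : ℝ) ≤ K * n := (le_max_right _ _).trans hKn
  set B := n / (3 * T) with hB
  have h3T : 0 < 3 * T := by omega
  have hn2 : 3 * T * B ≤ n := Nat.mul_div_le n (3 * T)
  have hn3 : n ≤ 3 * T * (B + 1) := (Nat.lt_mul_div_succ n h3T).le
  have hBB : B₀ ≤ B := by
    rw [hB, Nat.le_div_iff_mul_le h3T, mul_comm]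
    exact hnB
  have hBr : max x₀ (320 / ε) ≤ B := (Nat.le_ceil _).trans (by exact_mod_cast hBB)
  have hB1 : x₀ ≤ B := (le_max_left _ _).trans hBr
  have hB2 : 320 / ε ≤ B := (le_max_right _ _).trans hBr
  obtain ⟨M, hM⟩ : ∃ M, M = T * B ^ 2 + T * B := ⟨_, rfl⟩
  have hBM : B ≤ M := by
    rw [hM]
    exact (Nat.le_mul_of_pos_left B hT0).trans (Nat.le_add_left _ _)
  obtain ⟨hlog1, hlog2⟩ := hx₀ M (hB1.trans (by exact_mod_cast hBM))
  obtain ⟨f, hC, hhard⟩ := exists_hard_function hε hε1 hM hT hn1 hn2 hn3 hB2 hlog1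
  obtain ⟨C, hCf, hCM⟩ := hC
  set A : Set ℕ := {m : ℕ | ∃ C : XagCircuit n, C.Computes f ∧ C.andCount = m} with hA
  have hAne : A.Nonempty := ⟨_, C, hCf, rfl⟩
  have hmin : HasMultComplexity f (sInf A) :=
    ⟨Nat.sInf_mem hAne, fun m hm => Nat.sInf_le hm⟩
  have hle : sInf A ≤ M := (Nat.sInf_le (show C.andCount ∈ A from ⟨C, hCf, rfl⟩)).trans hCM
  have hn0 : (1 : ℝ) ≤ n := by exact_mod_cast hn1
  have hlogpos : 0 < Real.logb 2 (M : ℝ) := lt_of_lt_of_le (by positivity) hlog1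
  have hlarge : K * n ≤ (sInf A : ℕ) := by
    by_contra hcon
    rw [not_le] at hcon
    set M₁ := ⌈K * n⌉₊ with hM₁
    have h1 : K * n ≤ M₁ := Nat.le_ceil _
    have h2 : (M₁ : ℝ) < K * n + 1 := Nat.ceil_lt_add_one (by linarith)
    obtain ⟨C₁, hC₁, hC₁m⟩ := Nat.sInf_mem hAne
    obtain ⟨C₂, hC₂, hsize⟩ := hM₀ n M₁ (Nat.cast_le.1 (hKM.trans h1)) h1 f
      ⟨C₁, hC₁, hC₁m.trans_le (Nat.cast_le.1 (hcon.le.trans h1))⟩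
    have hlog3 : 1 ≤ Real.logb 2 (M₁ : ℝ) := by
      rw [Real.le_logb_iff_rpow_le one_lt_two (by linarith), Real.rpow_one]
      linarith
    have h3 : (C₂.size : ℝ) ≤ (K + 1) * (K + 3) * (n : ℝ) ^ 2 := by
      have h4 : (M₁ : ℝ) * (M₁ + 2 * n) / Real.logb 2 (M₁ : ℝ) ≤ M₁ * (M₁ + 2 * n) :=
        div_le_self (by positivity) hlog3
      have h5 : (M₁ : ℝ) ≤ (K + 1) * n := by linarith
      have h6 : (M₁ : ℝ) + 2 * n ≤ (K + 3) * n := by linarith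
      have h7 : (M₁ : ℝ) * (M₁ + 2 * n) ≤ ((K + 1) * n) * ((K + 3) * n) := by gcongr
      linarith
    have h4 := hhard C₂ hC₂
    have hTr : (1 : ℝ) ≤ T := by exact_mod_cast hT0
    have hBpos : (1 : ℝ) ≤ B := by
      have : (0 : ℝ) < B := lt_of_lt_of_le (by positivity) hB2
      exact_mod_cast this
    have hTB : (T : ℝ) * 1 ≤ T * B := by gcongr
    have hMr : (M : ℝ) = T * B ^ 2 + T * B := by exact_mod_cast hM
    have hnr : (n : ℝ) ≤ 3 * T * (B + 1) := by exact_mod_cast hn3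
    have h5 : (n : ℝ) ≤ 6 * (T * B) := by linarith
    have h6 : (n : ℝ) ^ 2 ≤ 36 * T * M := by
      have h7 : (n : ℝ) ^ 2 ≤ (6 * (T * B)) ^ 2 := by gcongr
      have h8 : 0 ≤ (T : ℝ) * (T * B) := by positivity
      rw [hMr]
      linarith
    have h7 : c₀ * M ≤ (M : ℝ) * (M + 2 * n) / Real.logb 2 (M : ℝ) := by
      rw [le_div_iff₀ hlogpos]
      have h8 : 0 ≤ (M : ℝ) * (2 * n) := by positivity
      have h9 := mul_le_mul_of_nonneg_left hlog2 (Nat.cast_nonneg (α := ℝ) M)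
      linarith
    have h8 : 1 / 4 * (c₀ * M) ≤
        (1 / 2 - ε) * ((M : ℝ) * (M + 2 * n) / Real.logb 2 (M : ℝ)) := by
      have h9 : 0 ≤ c₀ * M := by positivity
      exact mul_le_mul (by linarith) h7 h9 (by linarith)
    have h9 : (K + 1) * (K + 3) * (n : ℝ) ^ 2 ≤ (K + 1) * (K + 3) * (36 * T * M) := by gcongr
    rw [hc₀] at h8
    linarith
  refine ⟨f, sInf A, hmin, hlarge, fun C hC => ?_⟩
  refine le_trans ?_ (hhard C hC).le
  have hmono := size_bound_mono (Nat.cast_nonneg (α := ℝ) n) (hK3.trans hlarge)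
    (Nat.cast_le (α := ℝ).2 hle)
  exact mul_le_mul_of_nonneg_left hmono (by linarith)

theorem mainTheorem1 :
    (∀ c : ℝ, 0 < c → ∀ ε : ℝ, 0 < ε → ∃ M₀ : ℕ, ∀ n M : ℕ, M₀ ≤ M → c * (n : ℝ) ≤ (M : ℝ) →
      ∀ f : (Fin n → Bool) → Bool,
        (∃ C : XagCircuit n, C.Computes f ∧ C.andCount = M) →
        ∃ C : XagCircuit n, C.Computes f ∧
          (C.size : ℝ) ≤ (1 / 2 + ε) * ((M : ℝ) * ((M : ℝ) + 2 * (n : ℝ)) / Real.logb 2 (M : ℝ))) ∧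
    (∀ K : ℝ, 0 < K → ∀ ε : ℝ, 0 < ε → ∃ n₀ : ℕ, ∀ n : ℕ, n₀ ≤ n →
      ∃ (f : (Fin n → Bool) → Bool) (M : ℕ), HasMultComplexity f M ∧ K * (n : ℝ) ≤ (M : ℝ) ∧
        ∀ C : XagCircuit n, C.Computes f →
          (1 / 2 - ε) * ((M : ℝ) * ((M : ℝ) + 2 * (n : ℝ)) / Real.logb 2 (M : ℝ)) ≤ (C.size : ℝ)) := by
  refine ⟨fun c hc ε hε => ?_, fun K hK ε hε => ?_⟩
  · obtain ⟨M₀, h⟩ := exists_small_circuit c hc ε hε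
    exact ⟨M₀, fun n M hM hcn f ⟨C, hC, hCM⟩ => h n M hM hcn f ⟨C, hC, hCM.le⟩⟩
  · obtain ⟨n₀, h⟩ := exists_function_of_large_size K hK (min ε (1 / 4)) (by positivity)
      (min_le_right _ _)
    refine ⟨n₀, fun n hn => ?_⟩
    obtain ⟨f, M, hM, hKM, hf⟩ := h n hn
    refine ⟨f, M, hM, hKM, fun C hC => le_trans ?_ (hf C hC)⟩
    have hnonneg : 0 ≤ (M : ℝ) * ((M : ℝ) + 2 * (n : ℝ)) / Real.logb 2 (M : ℝ) := by
      refine div_nonneg (by positivity) ?_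
      rcases Nat.eq_zero_or_pos M with rfl | hpos
      · simp
      · exact Real.logb_nonneg one_lt_two (by exact_mod_cast hpos)
    have := min_le_left ε (1 / 4)
    gcongr
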